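/- **Notation.** Let $M_0=\bigoplus_{i\ge 0}\mathbb Z b_i$ be the free abelian group with basis $b_0,b_1,\dots$ (and put $b_i=0$ for $i<0$), and let $r\ge 1$. Let $\mathcal G_r\subseteq\bigwedge^rM_0$ be the Grassmann cone, i.e. the set of all $m_1\wedge\cdots\wedge m_r$ with $m_1,\dots,m_r\in M_0$. Let $\mathcal P_r$ be the set of partitions $\lambda=(\lambda_1\ge\cdots\ge\lambda_r\ge 0)$; we regard $\mathcal P_r\subseteq\mathcal P_{r+1}$ by appending a part $0$. For $\lambda\in\mathcal P_r$ put $[\mathbf b]^r_\lambda=b_{\lambda_r}\wedge b_{1+\lambda_{r-1}}\wedge\cdots\wedge b_{r-1+\lambda_1}$; these elements form a $\mathbb Z$-basis of $\bigwedge^rM_0$. For $s\ge 0$ let $B_s=\mathbb Z[e_1,\dots,e_s]$ (so $B_0=\mathbb Z$), $E_s(z)=1-e_1z+\cdots+(-1)^se_sz^s$, and let $H_s=(h_n)_{n\in\mathbb Z}$ be the sequence in $B_s$ with $\sum_{n}h_nz^n=1/E_s(z)$ in $B_s[[z]]$ (so $h_n=0$ for $n<0$). For $\lambda\in\mathcal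 P_r$ and a sequence $(g_n)_{n\in\mathbb Z}$ in a commutative ring put $\Delta_\lambda(g)=\det(g_{\lambda_j-j+i})_{1\le i,j\le r}$. The elements $\Delta_\lambda(H_s)$, $\lambda\in\mathcal P_s$, form a $\mathbb Z$-basis of $B_s$, and $\phi_s:B_s\to\bigwedge^sM_0$ denotes the isomorphism of abelian groups with $\phi_s(\Delta_\lambda(H_s))=[\mathbf b]^s_\lambda$. Let $\sigma_-(z):\bigwedge M_0\to(\bigwedge M_0)[z^{-1}]$ be the unique homomorphism of $\mathbb Z$-algebras with $\sigma_-(z)b_j=\sum_{i\ge 0}b_{j-i}z^{-i}$, and let $\overline\sigma_-(z)$ be its inverse in $\mathrm{End}_{\mathbb Z}(\bigwedge M_0)[[z^{-1}]]$, i.e. the unique homomorphism of $\mathbb Z$-algebras with $\overline\sigma_-(z)b_j=b_j-b_{j-1}z^{-1}$. Both are regarded as maps $B_s\to B_s[z^{-1}]$ through $\phi_s$, i.e. $p\mapsto\phi_s^{-1}(\sigma_-(z)\phi_s(p))$ and $p\mapsto\phi_s^{-1}(\overline\sigma_-(z)\phi_s(p))$. Let $\sigma_-(z)H_s=(\sigma_-(z)h_n)_{n\in\mathbb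 Z}$ for $s\ge 1$; for $s=0$, by convention, the $n$-th term of $\sigma_-(z)H_0$ is $z^{-n}$ if $n\ge 0$ and $0$ if $n<0$. Finally, $\mathrm{Res}_z$ is the coefficient of $z^{-1}$ of a Laurent series in $z$, and for $f=\sum_if_iz^i$ and $g=\sum_jg_jz^j$ we write $f\otimes g=\sum_{i,j}(f_i\otimes g_j)z^{i+j}$. **Theorem.** Let $r\ge 1$ and let $\mathbf m=\sum_{\lambda\in\mathcal P_r}a_\lambda[\mathbf b]^r_\lambda\in\bigwedge^rM_0$, with integers $a_\lambda$, all but finitely many of them zero. Then $\mathbf m\in\mathcal G_r$ if and only if $$\mathrm{Res}_z\sum_{\lambda,\mu\in\mathcal P_r}a_\lambda a_\mu\;E_{r-1}(z)\,\Delta_\lambda(\sigma_-(z)H_{r-1})\otimes\frac1{E_{r+1}(z)}\,\overline\sigma_-(z)\Delta_\mu(H_{r+1})=0$$ in $B_{r-1}\otimes_{\mathbb Z}B_{r+1}$. -/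

import Mathlib

open scoped TensorProduct

namespace SchubertCone

noncomputable section

/-! ### Partitions, Schur determinants, and the two bases -/

/-- Partitions `λ₁ ≥ ⋯ ≥ λ_r ≥ 0` with at most `r` parts; `λ_j` is `lam.1 (j - 1)`. -/
def Ptn (r : ℕ) : Type := {lam : Fin r → ℕ // Antitone lam}

/-- A partition with at most `r` parts, seen as one with at most `r + 1` parts. -/
def Ptn.succ {r : ℕ} (lam : Ptn r) : Ptn (r + 1) :=
  ⟨Fin.snoc (α := fun _ => ℕ) lam.1 0, by
    intro i j hij
    induction j using Fin.lastCases with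
    | last => simp
    | cast j =>
      induction i using Fin.lastCases with
      | last => exact absurd hij (by simp [Fin.le_def, j.isLt])
      | cast i => simpa using lam.2 (by simpa using hij)⟩

/-- The strictly increasing sequence `λ_r < 1 + λ_{r-1} < ⋯ < r - 1 + λ₁`. -/
def Ptn.index {r : ℕ} (lam : Ptn r) (k : Fin r) : ℕ := (k : ℕ) + lam.1 k.rev

/-- The Schur determinant `det (h_{λ_j - j + i})` of a bilateral sequence. -/
def schurDet {R : Type*} [CommRing R] {r : ℕ} (lam : Ptn r) (h : ℤ → R) : R :=
  Matrix.det (Matrix.of fun i j : Fin r => h ((lam.1 j : ℤ) - (j : ℤ) + (i : ℤ)))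

/-- `B_r = ℤ[e₁, …, e_r]`; the indeterminate `e_j` is `X (j - 1)`. -/
abbrev B (r : ℕ) : Type := MvPolynomial (Fin r) ℤ

/-- `E_r(z) = 1 - e₁ z + ⋯ + (-1)^r e_r z^r`. -/
def E (r : ℕ) : PowerSeries (B r) :=
  1 + ∑ j : Fin r, PowerSeries.monomial ((j : ℕ) + 1) ((-1) ^ ((j : ℕ) + 1) * MvPolynomial.X j)

/-- `1 / E_r(z) = ∑ₙ (1 - E_r(z))ⁿ`. -/
def invE (r : ℕ) : PowerSeries (B r) := PowerSeries.invOfUnit (E r) 1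

/-- The bilateral sequence `H_r = (h_n)` of coefficients of `1 / E_r(z)`. -/
def h (r : ℕ) (n : ℤ) : B r := if 0 ≤ n then PowerSeries.coeff n.toNat (invE r) else 0

theorem constantCoeff_E (r : ℕ) : PowerSeries.constantCoeff (E r) = 1 := by
  rw [← PowerSeries.coeff_zero_eq_constantCoeff_apply, E, map_add, map_sum]
  simp only [PowerSeries.coeff_monomial]
  simp

theorem E_mul_invE (r : ℕ) : E r * invE r = 1 :=
  PowerSeries.mul_invOfUnit _ _ (by simp [constantCoeff_E])

theorem h_natCast (r n : ℕ) : h r (n : ℤ) = PowerSeries.coeff n (invE r) := by simp [h]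

theorem h_zero (r : ℕ) : h r 0 = 1 := by
  have := h_natCast r 0
  simpa [invE] using this

theorem h_neg (r : ℕ) {n : ℤ} (hn : n < 0) : h r n = 0 := by simp [h, hn]

theorem Ptn.index_strictMono {r : ℕ} (lam : Ptn r) : StrictMono lam.index := by
  intro i j hij
  have h1 := lam.2 (Fin.rev_le_rev.mpr hij.le)
  have h2 : (i : ℕ) < j := hij
  simp only [Ptn.index]
  omega

theorem Ptn.ext_index {r : ℕ} {lam mu : Ptn r} (hlm : lam.index = mu.index) : lam = mu := by
  apply Subtype.ext
  funext j
  have := congrFun hlm j.rev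
  simpa [Ptn.index] using this

theorem strictMono_sub {r : ℕ} {f : Fin r → ℕ} (hf : StrictMono f) {i j : Fin r} (hij : i ≤ j) :
    f i + ((j : ℕ) - i) ≤ f j := by
  obtain ⟨i, hi⟩ := i
  obtain ⟨j, hj⟩ := j
  simp only [Fin.mk_le_mk] at hij
  induction j, hij using Nat.le_induction with
  | base => simp
  | succ k hk ih =>
    have h1 := ih (by omega)
    have h2 : f ⟨k, by omega⟩ < f ⟨k + 1, hj⟩ := hf (by simp [Fin.lt_def])
    simp only at h1 ⊢
    omega

theorem strictMono_ge {r : ℕ} {f : Fin r → ℕ} (hf : StrictMono f) (j : Fin r) : (j : ℕ) ≤ f j := by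
  have := strictMono_sub hf (i := ⟨0, j.pos⟩) (j := j) (by simp [Fin.le_def])
  simp only at this
  omega

theorem exists_ptn {r : ℕ} {f : Fin r → ℕ} (hf : StrictMono f) : ∃ lam : Ptn r, lam.index = f := by
  refine ⟨⟨fun j => f j.rev - (j.rev : ℕ), ?_⟩, ?_⟩
  · intro i j hij
    have h1 := strictMono_sub hf (Fin.rev_le_rev.mpr hij)
    have h2 := strictMono_ge hf j.rev
    have h3 : ((j.rev : Fin r) : ℕ) ≤ (i.rev : Fin r) := Fin.rev_le_rev.mpr hij
    simp only
    omega
  · funext k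
    have := strictMono_ge hf k
    simp only [Ptn.index, Fin.rev_rev]
    omega

/-- The partitions with at most `r` parts correspond to the increasing sequences of length `r`. -/
def ptnEquiv (r : ℕ) : Ptn r ≃ (Fin r ↪o ℕ) :=
  Equiv.ofBijective (fun lam => OrderEmbedding.ofStrictMono lam.index lam.index_strictMono) <| by
    refine ⟨fun lam mu hlm => Ptn.ext_index ?_, fun f => ?_⟩
    · funext k
      exact congrArg (fun g : Fin r ↪o ℕ => g k) hlm
    · obtain ⟨lam, hlam⟩ := exists_ptn f.strictMono
      refine ⟨lam, ?_⟩
      ext k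
      exact congrFun hlam k

/-- The determinant `det (h_{f_b - l})`, for any sequence `f` of indices. -/
def hDet (r : ℕ) (f : Fin r → ℕ) : B r :=
  Matrix.det (Matrix.of fun l b : Fin r => h r ((f b : ℤ) - (l : ℤ)))

theorem hDet_index (r : ℕ) (lam : Ptn r) : hDet r lam.index = schurDet lam (h r) := by
  rw [hDet, schurDet, ← Matrix.det_submatrix_equiv_self (Fin.revPerm : Equiv.Perm (Fin r))]
  congr 1
  ext1 i j
  simp only [Matrix.submatrix_apply, Matrix.of_apply, Fin.revPerm_apply, Ptn.index, Fin.rev_rev]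
  congr 1
  simp only [Fin.val_rev]
  have := i.isLt
  have := j.isLt
  omega

/-- `e_j` as an elementary symmetric polynomial in `x₁, …, x_r`. -/
def theta (r : ℕ) : B r →ₐ[ℤ] MvPolynomial (Fin r) ℤ :=
  (Subalgebra.val _).comp (MvPolynomial.esymmAlgHom (Fin r) ℤ r)

theorem theta_injective (r : ℕ) : Function.Injective (theta r) :=
  Subtype.val_injective.comp (MvPolynomial.esymmAlgHom_injective ℤ (by simp))

theorem theta_X (r : ℕ) (j : Fin r) :
    theta r (MvPolynomial.X j) = MvPolynomial.esymm (Fin r) ℤ ((j : ℕ) + 1) := by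
  simp [theta, MvPolynomial.esymmAlgHom]

/-- The alternant `det (x_a ^ f_b)`. -/
def alt (r : ℕ) (f : Fin r → ℕ) : MvPolynomial (Fin r) ℤ :=
  Matrix.det (Matrix.of fun a b : Fin r => (MvPolynomial.X a : MvPolynomial (Fin r) ℤ) ^ f b)

theorem coeff_prod_one_sub {R : Type*} [CommRing R] {s : Type*} (S : Finset s) (x : s → R) (n : ℕ) :
    PowerSeries.coeff n (∏ c ∈ S, (1 - PowerSeries.C (x c) * PowerSeries.X)) =
      (-1) ^ n * ∑ t ∈ S.powersetCard n, ∏ i ∈ t, x i := by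
  classical
  have h1 : ∀ c, (1 - PowerSeries.C (x c) * PowerSeries.X : PowerSeries R)
      = 1 + PowerSeries.monomial 1 (- x c) := by
    intro c
    rw [sub_eq_add_neg]
    congr 1
    ext n
    simp [PowerSeries.coeff_monomial, PowerSeries.coeff_X]
  have h2 : ∀ t : Finset s, ∏ i ∈ t, (PowerSeries.monomial 1 (- x i) : PowerSeries R)
      = PowerSeries.monomial t.card ((-1) ^ t.card * ∏ i ∈ t, x i) := by
    intro t
    induction t using Finset.induction_on with
    | empty => simp
    | insert a t ha ih =>
      rw [Finset.prod_insert ha, ih, PowerSeries.monomial_mul_monomial, Finset.card_insert_of_notMem ha,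
        Finset.prod_insert ha, add_comm]
      congr 1
      ring
  simp_rw [h1, Finset.prod_one_add, h2, map_sum, PowerSeries.coeff_monomial]
  rw [Finset.powersetCard_eq_filter, Finset.sum_filter, Finset.mul_sum]
  refine Finset.sum_congr rfl fun t _ => ?_
  by_cases hn : t.card = n
  · simp [hn]
  · simp [hn, Ne.symm hn]

theorem map_theta_E (r : ℕ) : PowerSeries.map (theta r : B r →+* MvPolynomial (Fin r) ℤ) (E r) =
    ∏ c : Fin r, (1 - PowerSeries.C (MvPolynomial.X c) * PowerSeries.X) := by
  ext1 n
  rw [coeff_prod_one_sub]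
  rw [PowerSeries.coeff_map, E]
  simp only [map_add, map_sum, PowerSeries.coeff_monomial, PowerSeries.coeff_one]
  change _ = (-1) ^ n * MvPolynomial.esymm (Fin r) ℤ n
  rcases n with _ | n
  · simp
  · by_cases hn : n < r
    · rw [Finset.sum_eq_single (⟨n, hn⟩ : Fin r)]
      · simp [theta_X]
      · intro j _ hj
        have : (n : ℕ) ≠ j := fun h => hj (Fin.ext h.symm)
        simp [this]
      · simp
    · rw [Finset.sum_eq_zero]
      · simp only [MvPolynomial.esymm]
        rw [Finset.powersetCard_eq_empty.mpr (by simpa using Nat.lt_succ_of_le (not_lt.mp hn))]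
        simp
      · intro j _
        have : (n : ℕ) ≠ j := by have := j.isLt; omega
        simp [this]

/-- The transition matrix from the sequences `h` to the powers of the `x_a`. -/
def transMat (r : ℕ) : Matrix (Fin r) (Fin r) (MvPolynomial (Fin r) ℤ) :=
  Matrix.of fun a l => PowerSeries.coeff (l : ℕ)
    (∏ c ∈ Finset.univ.erase a, (1 - PowerSeries.C (MvPolynomial.X c) * PowerSeries.X))

theorem pow_eq_sum (r : ℕ) (a : Fin r) (n : ℕ) :
    (MvPolynomial.X a : MvPolynomial (Fin r) ℤ) ^ n =
      ∑ l : Fin r, transMat r a l * theta r (h r ((n : ℤ) - (l : ℤ))) := by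
  classical
  set P : PowerSeries (MvPolynomial (Fin r) ℤ) :=
    ∏ c ∈ Finset.univ.erase a, (1 - PowerSeries.C (MvPolynomial.X c) * PowerSeries.X) with hP
  set G : PowerSeries (MvPolynomial (Fin r) ℤ) := PowerSeries.mk fun n => MvPolynomial.X a ^ n with hG
  have hG1 : (1 - PowerSeries.C (MvPolynomial.X a) * PowerSeries.X) * G = 1 := by
    ext1 m
    rw [sub_mul, one_mul, mul_assoc, map_sub, PowerSeries.coeff_C_mul]
    rcases m with _ | m
    · simp [hG]
    · rw [PowerSeries.coeff_succ_X_mul]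
      simp [hG, PowerSeries.coeff_one, pow_succ']
  have hE : PowerSeries.map (theta r : B r →+* MvPolynomial (Fin r) ℤ) (E r) *
      PowerSeries.map (theta r : B r →+* MvPolynomial (Fin r) ℤ) (invE r) = 1 := by
    rw [← map_mul, E_mul_invE, map_one]
  have hGP : G = P * PowerSeries.map (theta r : B r →+* MvPolynomial (Fin r) ℤ) (invE r) := by
    rw [map_theta_E, ← Finset.mul_prod_erase _ _ (Finset.mem_univ a), ← hP] at hE
    calc G = G * ((1 - PowerSeries.C (MvPolynomial.X a) * PowerSeries.X) * P *
          PowerSeries.map (theta r : B r →+* MvPolynomial (Fin r) ℤ) (invE r)) := by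
            rw [hE, mul_one]
      _ = ((1 - PowerSeries.C (MvPolynomial.X a) * PowerSeries.X) * G) *
          (P * PowerSeries.map (theta r : B r →+* MvPolynomial (Fin r) ℤ) (invE r)) := by ring
      _ = _ := by rw [hG1, one_mul]
  have hdeg : ∀ m, r ≤ m → PowerSeries.coeff m P = 0 := by
    intro m hm
    rw [hP, coeff_prod_one_sub, Finset.powersetCard_eq_empty.mpr]
    · simp
    · rw [Finset.card_erase_of_mem (Finset.mem_univ a), Finset.card_univ, Fintype.card_fin]
      have := a.pos
      omega
  have h1 : (MvPolynomial.X a : MvPolynomial (Fin r) ℤ) ^ n = PowerSeries.coeff n G := by simp [hG]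
  rw [h1, hGP, PowerSeries.coeff_mul, Finset.Nat.sum_antidiagonal_eq_sum_range_succ_mk]
  have h2 : ∀ k ∈ Finset.range (n + 1), PowerSeries.coeff k P * PowerSeries.coeff (n - k)
      (PowerSeries.map (theta r : B r →+* MvPolynomial (Fin r) ℤ) (invE r)) =
      PowerSeries.coeff k P * theta r (h r ((n : ℤ) - (k : ℤ))) := by
    intro k hk
    have hk' : k ≤ n := by simpa [Nat.lt_succ_iff] using hk
    rw [PowerSeries.coeff_map, ← h_natCast, Nat.cast_sub hk']
    rfl
  rw [Finset.sum_congr rfl h2]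
  change _ = ∑ l : Fin r, PowerSeries.coeff (l : ℕ) P * theta r (h r ((n : ℤ) - ((l : ℕ) : ℤ)))
  rw [Fin.sum_univ_eq_sum_range
    (fun l => PowerSeries.coeff l P * theta r (h r ((n : ℤ) - (l : ℤ)))) r]
  rcases le_total r (n + 1) with hrn | hrn
  · symm
    apply Finset.sum_subset (Finset.range_mono hrn)
    intro k _ hk
    rw [hdeg k (by simpa using hk), zero_mul]
  · apply Finset.sum_subset (Finset.range_mono hrn)
    intro k _ hk
    rw [h_neg r (by have : n + 1 ≤ k := by simpa using hk
                    omega), map_zero, mul_zero]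

theorem alt_eq_mul (r : ℕ) (f : Fin r → ℕ) : alt r f = (transMat r).det * theta r (hDet r f) := by
  have h1 : theta r (hDet r f) =
      (Matrix.of fun l b : Fin r => theta r (h r ((f b : ℤ) - (l : ℤ)))).det := by
    rw [hDet, AlgHom.map_det]
    rfl
  rw [h1, ← Matrix.det_mul, alt]
  congr 1
  ext1 a b
  rw [Matrix.mul_apply]
  exact pow_eq_sum r a (f b)

theorem transMat_det_ne_zero (r : ℕ) : (transMat r).det ≠ 0 := by
  intro h0
  have h1 := alt_eq_mul r (fun b => (b : ℕ))
  rw [h0, zero_mul] at h1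
  have h2 : alt r (fun b => (b : ℕ)) =
      (Matrix.vandermonde (fun a : Fin r => (MvPolynomial.X a : MvPolynomial (Fin r) ℤ))).det := rfl
  rw [h2] at h1
  exact (Matrix.det_vandermonde_ne_zero_iff.mpr (MvPolynomial.X_injective)) h1

theorem alt_eq_sum (r : ℕ) (f : Fin r → ℕ) : alt r f = ∑ s : Equiv.Perm (Fin r),
    Equiv.Perm.sign s • MvPolynomial.monomial (Finsupp.equivFunOnFinite.symm (f ∘ s.symm)) (1 : ℤ) := by
  rw [alt, Matrix.det_apply]
  refine Finset.sum_congr rfl fun s _ => ?_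
  congr 1
  rw [MvPolynomial.monomial_eq, Finsupp.prod_fintype _ _ (by simp)]
  simp only [Matrix.of_apply, map_one, one_mul]
  rw [← Equiv.prod_comp s fun a => (MvPolynomial.X a : MvPolynomial (Fin r) ℤ) ^
    (Finsupp.equivFunOnFinite.symm (f ∘ s.symm)) a]
  simp

theorem coeff_alt (r : ℕ) {f g : Fin r → ℕ} (hf : StrictMono f) (hg : StrictMono g) :
    MvPolynomial.coeff (Finsupp.equivFunOnFinite.symm f) (alt r g) = if f = g then 1 else 0 := by
  classical
  rw [alt_eq_sum, MvPolynomial.coeff_sum]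
  have key : ∀ s : Equiv.Perm (Fin r), g ∘ s.symm = f → s = 1 := by
    intro s hs
    have hmono : StrictMono s.symm := by
      intro i j hij
      have := hf hij
      rw [← hs] at this
      exact hg.lt_iff_lt.mp this
    have h2 : (hmono.orderIsoOfSurjective _ s.symm.surjective) = OrderIso.refl (Fin r) :=
      Subsingleton.elim _ _
    ext i
    have h3 : s.symm (s i) = s i := congrArg (fun e : Fin r ≃o Fin r => e (s i)) h2
    rw [Equiv.symm_apply_apply] at h3
    simp [← h3]
  rw [Finset.sum_eq_single 1]
  · have : (g ∘ (1 : Equiv.Perm (Fin r)).symm) = g := rfl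
    rw [this]
    simp [MvPolynomial.coeff_monomial, eq_comm]
  · intro s _ hs
    have : g ∘ s.symm ≠ f := fun h => hs (key s h)
    have h2 : Finsupp.equivFunOnFinite.symm (g ∘ s.symm) ≠ Finsupp.equivFunOnFinite.symm f :=
      fun h => this (Finsupp.equivFunOnFinite.symm.injective h)
    rw [Units.smul_def, MvPolynomial.coeff_smul, MvPolynomial.coeff_monomial, if_neg h2, smul_zero]
  · simp

theorem schurDet_linearIndependent (r : ℕ) :
    LinearIndependent ℤ (fun lam : Ptn r => schurDet lam (h r)) := by
  have hlin : LinearIndependent ℤ (fun lam : Ptn r => alt r lam.index) := by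
    refine LinearIndependent.of_pairwise_dual_eq_zero_one _
      (fun lam => MvPolynomial.lcoeff ℤ (Finsupp.equivFunOnFinite.symm lam.index)) ?_ ?_
    · intro lam mu hlm
      simp only [MvPolynomial.lcoeff_apply]
      rw [coeff_alt r lam.index_strictMono mu.index_strictMono,
        if_neg fun hh => hlm (Ptn.ext_index hh)]
    · intro lam
      simp only [MvPolynomial.lcoeff_apply]
      rw [coeff_alt r lam.index_strictMono lam.index_strictMono, if_pos rfl]
  refine LinearIndependent.of_comp
    ((LinearMap.mulLeft ℤ (transMat r).det).comp (theta r).toLinearMap) ?_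
  have heq : (⇑((LinearMap.mulLeft ℤ (transMat r).det).comp (theta r).toLinearMap) ∘
      fun lam : Ptn r => schurDet lam (h r)) = fun lam : Ptn r => alt r lam.index := by
    funext lam
    simp [alt_eq_mul, hDet_index]
  rw [heq]
  exact hlin

theorem sum_alt (r k : ℕ) (f : Fin r → ℕ) :
    ∑ t ∈ (Finset.univ : Finset (Fin r)).powersetCard k,
      alt r (fun b => f b + if b ∈ t then 1 else 0) =
      MvPolynomial.esymm (Fin r) ℤ k * alt r f := by
  simp_rw [alt, Matrix.det_apply, Matrix.of_apply]
  rw [Finset.sum_comm, Finset.mul_sum]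
  refine Finset.sum_congr rfl fun s _ => ?_
  rw [← Finset.smul_sum, mul_smul_comm]
  congr 1
  simp_rw [pow_add, Finset.prod_mul_distrib]
  rw [← Finset.mul_sum, mul_comm]
  congr 1
  rw [← MvPolynomial.rename_esymm (Fin r) ℤ k s, MvPolynomial.esymm, map_sum]
  refine Finset.sum_congr rfl fun t _ => ?_
  rw [map_prod]
  simp [pow_ite, Finset.prod_ite_mem]

theorem X_mul_hDet (r : ℕ) (j : Fin r) (f : Fin r → ℕ) :
    MvPolynomial.X j * hDet r f = ∑ t ∈ (Finset.univ : Finset (Fin r)).powersetCard ((j : ℕ) + 1),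
      hDet r (fun b => f b + if b ∈ t then 1 else 0) := by
  apply theta_injective r
  apply mul_left_cancel₀ (transMat_det_ne_zero r)
  have h1 := sum_alt r ((j : ℕ) + 1) f
  simp_rw [alt_eq_mul] at h1
  rw [map_sum, Finset.mul_sum, h1, map_mul, theta_X]
  ring

theorem hDet_mem_span (r : ℕ) (f : Fin r → ℕ) :
    hDet r f ∈ Submodule.span ℤ (Set.range fun lam : Ptn r => schurDet lam (h r)) := by
  by_cases hf : Function.Injective f
  · set s := Tuple.sort f with hs
    have hmono : StrictMono (f ∘ s) :=
      (Tuple.monotone_sort f).strictMono_of_injective (hf.comp s.injective)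
    obtain ⟨lam, hlam⟩ := exists_ptn hmono
    have h1 : schurDet lam (h r) = ((Equiv.Perm.sign s : ℤˣ) : B r) * hDet r f := by
      rw [← hDet_index, hlam, hDet, hDet, ← Matrix.det_permute']
      rfl
    have h2 : hDet r f = ((Equiv.Perm.sign s : ℤˣ) : ℤ) • schurDet lam (h r) := by
      rw [h1, zsmul_eq_mul, ← mul_assoc]
      rcases Int.units_eq_one_or (Equiv.Perm.sign s) with h | h <;> simp [h]
    rw [h2]
    exact Submodule.smul_mem _ _ (Submodule.subset_span ⟨lam, rfl⟩)
  · obtain ⟨i, j, hij, hne⟩ : ∃ i j, f i = f j ∧ i ≠ j := by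
      simpa [Function.Injective] using hf
    have : hDet r f = 0 := Matrix.det_zero_of_column_eq hne (by intro l; simp [hij])
    rw [this]
    exact Submodule.zero_mem _

theorem schurDet_span (r : ℕ) :
    ⊤ ≤ Submodule.span ℤ (Set.range fun lam : Ptn r => schurDet lam (h r)) := by
  set N := Submodule.span ℤ (Set.range fun lam : Ptn r => schurDet lam (h r)) with hN
  have hone : (1 : B r) ∈ N := by
    have h1 : hDet r (fun b => (b : ℕ)) = 1 := by
      rw [hDet, Matrix.det_of_isUpperTriangular]
      · simp [h_zero]
      · intro i j hij
        have hij' : (j : ℕ) < i := hij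
        exact h_neg r (by omega)
    rw [← h1]
    exact hDet_mem_span r _
  intro p _
  induction p using MvPolynomial.induction_on with
  | C a =>
    have : (MvPolynomial.C a : B r) = a • 1 := by
      rw [MvPolynomial.smul_eq_C_mul, mul_one]
    rw [this]
    exact N.smul_mem _ hone
  | add p q hp hq => exact N.add_mem (hp trivial) (hq trivial)
  | mul_X p j hp =>
    have hp' := hp trivial
    rw [hN] at hp'
    induction hp' using Submodule.span_induction with
    | mem x hx =>
      obtain ⟨lam, rfl⟩ := hx
      simp only
      rw [mul_comm, ← hDet_index, X_mul_hDet]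
      exact N.sum_mem fun t _ => hDet_mem_span r _
    | zero => simp
    | add x y _ _ hx hy =>
      rw [add_mul]
      exact N.add_mem (hx (fun _ => by assumption) trivial) (hy (fun _ => by assumption) trivial)
    | smul a x _ hx =>
      rw [smul_mul_assoc]
      exact N.smul_mem _ (hx (fun _ => by assumption) trivial)

/-- The `ℤ`-basis `(Δ_λ(H_r))` of `B_r`. -/
def schurBasis (r : ℕ) : Module.Basis (Ptn r) ℤ (B r) :=
  Module.Basis.mk (schurDet_linearIndependent r) (schurDet_span r)

theorem schurBasis_apply (r : ℕ) (lam : Ptn r) : schurBasis r lam = schurDet lam (h r) := by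
  simp [schurBasis]

/-- The free abelian group `M₀` on `b₀, b₁, …`. -/
abbrev M0 : Type := ℕ →₀ ℤ

/-- The basis element `b_i`, with `b_i = 0` for `i < 0`. -/
def b (i : ℤ) : M0 := if 0 ≤ i then Finsupp.single i.toNat 1 else 0

/-- `[b]^r_λ = b_{λ_r} ∧ b_{1 + λ_{r-1}} ∧ ⋯ ∧ b_{r - 1 + λ₁}`. -/
def bWedge {r : ℕ} (lam : Ptn r) : ⋀[ℤ]^r M0 :=
  exteriorPower.ιMulti ℤ r fun k : Fin r => b (lam.index k)

/-- The `ℤ`-basis `([b]^r_λ)` of `⋀^r M₀`. -/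
def wedgeBasis (r : ℕ) : Module.Basis (Ptn r) ℤ (⋀[ℤ]^r M0) :=
  (Module.Basis.exteriorPower r (Finsupp.basisSingleOne : Module.Basis ℕ ℤ M0)).reindex
    ((ptnEquiv r).trans Set.powersetCard.ofFinEmbEquiv).symm

theorem wedgeBasis_apply (r : ℕ) (lam : Ptn r) : wedgeBasis r lam = bWedge lam := by
  rw [wedgeBasis, Module.Basis.reindex_apply, exteriorPower.basis_apply,
    exteriorPower.ιMulti_family, bWedge]
  congr 1
  funext k
  simp only [Function.comp_apply, Equiv.symm_symm, Equiv.trans_apply, Equiv.symm_apply_apply,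
    Finsupp.coe_basisSingleOne, b, Int.natCast_nonneg, if_true, Int.toNat_natCast]
  rfl

/-- The isomorphism `φ_r : B_r → ⋀^r M₀` of abelian groups, `Δ_λ(H_r) ↦ [b]^r_λ`. -/
def phi (r : ℕ) : B r ≃ₗ[ℤ] ⋀[ℤ]^r M0 :=
  (schurBasis r).equiv (wedgeBasis r) (Equiv.refl _)

theorem phi_schurDet {r : ℕ} (lam : Ptn r) : phi r (schurDet lam (h r)) = bWedge lam := by
  rw [← schurBasis_apply, phi, Module.Basis.equiv_apply, Equiv.refl_apply, wedgeBasis_apply]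

/-! ### The Grassmann cone and the Schubert derivations -/

/-- The Grassmann cone: the image of `(m₁, …, m_r) ↦ m₁ ∧ ⋯ ∧ m_r`. -/
def grassmannCone (r : ℕ) : Set (⋀[ℤ]^r M0) :=
  Set.range fun m : Fin r → M0 => exteriorPower.ιMulti ℤ r m

/-- The exterior algebra `⋀ M₀`. -/
abbrev ExtM0 : Type := ExteriorAlgebra ℤ M0

/-- The polynomials over the exterior algebra all of whose coefficients lie in a submodule. -/
def CoeffsIn (N : Submodule ℤ ExtM0) (P : Polynomial ExtM0) : Prop := ∀ i, P.coeff i ∈ N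

theorem CoeffsIn.mul {N N' : Submodule ℤ ExtM0} {P Q : Polynomial ExtM0} (hP : CoeffsIn N P)
    (hQ : CoeffsIn N' Q) : CoeffsIn (N * N') (P * Q) := by
  intro n
  rw [Polynomial.coeff_mul]
  exact Submodule.sum_mem _ fun x _ => Submodule.mul_mem_mul (hP _) (hQ _)

theorem CoeffsIn.sq_eq_zero {P : Polynomial ExtM0}
    (hP : CoeffsIn (LinearMap.range (ExteriorAlgebra.ι ℤ (M := M0))) P) : P * P = 0 := by
  ext1 n
  rw [Polynomial.coeff_mul, Polynomial.coeff_zero]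
  refine Finset.sum_involution (fun x _ => x.swap) ?_ ?_ ?_ ?_
  · intro x _
    obtain ⟨u, hu⟩ := hP x.1
    obtain ⟨v, hv⟩ := hP x.2
    simp only [Prod.fst_swap, Prod.snd_swap]
    rw [← hu, ← hv]
    exact ExteriorAlgebra.ι_add_mul_swap u v
  · rintro ⟨i, j⟩ _ hne heq
    simp only [Prod.swap_prod_mk, Prod.mk.injEq] at heq
    obtain ⟨u, hu⟩ := hP i
    apply hne
    simp only [heq.1]
    rw [← hu]
    exact ExteriorAlgebra.ι_sq_zero u
  · intro x hx
    simpa [add_comm] using hx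
  · intro x _
    simp

/-- A family `d_j = ∑ᵢ d_{j,i} z^{-i}` of values on the basis elements `b_j`, with `d_{j,i} ∈ M₀`,
extends to a unique algebra homomorphism `⋀ M₀ → (⋀ M₀)[z^{-1}]`. The polynomial variable is
`z^{-1}`. -/
def hsDerivation (d : ℕ → Polynomial ExtM0)
    (hd : ∀ j, CoeffsIn (LinearMap.range (ExteriorAlgebra.ι ℤ (M := M0))) (d j)) :
    ExtM0 →ₐ[ℤ] Polynomial ExtM0 :=
  ExteriorAlgebra.lift ℤ ⟨Finsupp.linearCombination ℤ d, fun m => by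
    apply CoeffsIn.sq_eq_zero
    intro i
    rw [Finsupp.linearCombination_apply, Finsupp.sum, Polynomial.finsetSum_coeff]
    refine Submodule.sum_mem _ fun j _ => ?_
    rw [Polynomial.coeff_smul]
    exact Submodule.smul_mem _ _ (hd j i)⟩

theorem hsDerivation_b (d : ℕ → Polynomial ExtM0)
    (hd : ∀ j, CoeffsIn (LinearMap.range (ExteriorAlgebra.ι ℤ (M := M0))) (d j)) (j : ℕ) :
    hsDerivation d hd (ExteriorAlgebra.ι ℤ (b j)) = d j := by
  simp [hsDerivation, b]

theorem hsDerivation_coeff_mem (d : ℕ → Polynomial ExtM0)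
    (hd : ∀ j, CoeffsIn (LinearMap.range (ExteriorAlgebra.ι ℤ (M := M0))) (d j)) (r : ℕ)
    {x : ExtM0} (hx : x ∈ ⋀[ℤ]^r M0) : CoeffsIn (⋀[ℤ]^r M0) (hsDerivation d hd x) := by
  have h1 : ∀ m : M0, CoeffsIn (LinearMap.range (ExteriorAlgebra.ι ℤ (M := M0)))
      (hsDerivation d hd (ExteriorAlgebra.ι ℤ m)) := by
    intro m i
    rw [hsDerivation, ExteriorAlgebra.lift_ι_apply, Finsupp.linearCombination_apply, Finsupp.sum,
      Polynomial.finsetSum_coeff]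
    refine Submodule.sum_mem _ fun j _ => ?_
    rw [Polynomial.coeff_smul]
    exact Submodule.smul_mem _ _ (hd j i)
  induction hx using Submodule.pow_induction_on_left' with
  | algebraMap a =>
    intro i
    rw [AlgHom.commutes, Polynomial.algebraMap_apply, Polynomial.coeff_C]
    split
    · rw [ExteriorAlgebra.exteriorPower, pow_zero]
      exact Submodule.algebraMap_mem a
    · exact Submodule.zero_mem _
  | add x y i _ _ hx hy =>
    intro j
    rw [map_add, Polynomial.coeff_add]
    exact Submodule.add_mem _ (hx j) (hy j)
  | mem_mul m hm i x _ ih =>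
    obtain ⟨m, rfl⟩ := hm
    rw [map_mul, ExteriorAlgebra.exteriorPower, Nat.succ_eq_add_one, pow_succ']
    exact (h1 m).mul ih

/-- `σ_-(z) : ⋀ M₀ → (⋀ M₀)[z^{-1}]`, with `σ_-(z)(m ∧ m') = σ_-(z) m ∧ σ_-(z) m'` and
`σ_-(z) b_j = ∑ᵢ b_{j-i} z^{-i}`. -/
def sigmaMinus : ExtM0 →ₐ[ℤ] Polynomial ExtM0 :=
  hsDerivation
    (fun j => ∑ i ∈ Finset.range (j + 1), Polynomial.monomial i (ExteriorAlgebra.ι ℤ (b (j - i))))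
    (by
      intro j n
      rw [Polynomial.finsetSum_coeff]
      refine Submodule.sum_mem _ fun i _ => ?_
      rw [Polynomial.coeff_monomial]
      split
      · exact ⟨_, rfl⟩
      · exact Submodule.zero_mem _)

/-- `σ̄_-(z) : ⋀ M₀ → (⋀ M₀)[z^{-1}]`, the inverse of `σ_-(z)` (see
`sigmaMinus_mul_sigmaBarMinus`): the algebra homomorphism with
`σ̄_-(z) b_j = b_j - b_{j-1} z^{-1}`. -/
def sigmaBarMinus : ExtM0 →ₐ[ℤ] Polynomial ExtM0 :=
  hsDerivation
    (fun j => Polynomial.C (ExteriorAlgebra.ι ℤ (b j)) -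
      Polynomial.monomial 1 (ExteriorAlgebra.ι ℤ (b ((j : ℤ) - 1))))
    (by
      intro j n
      rw [Polynomial.coeff_sub, Polynomial.coeff_C, Polynomial.coeff_monomial]
      refine Submodule.sub_mem _ ?_ ?_ <;> split
      · exact ⟨_, rfl⟩
      · exact Submodule.zero_mem _
      · exact ⟨_, rfl⟩
      · exact Submodule.zero_mem _)

/-- `∑ᵢ D_i z^{-i}` as a formal power series, in the variable `z^{-1}`, of endomorphisms. -/
def toEndSeries (D : ExtM0 →ₐ[ℤ] Polynomial ExtM0) : PowerSeries (Module.End ℤ ExtM0) :=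
  PowerSeries.mk fun i => ((Polynomial.lcoeff ExtM0 i).restrictScalars ℤ).comp D.toLinearMap

/-- The `z^{-1}`-linear extension of an operator `D(z)` to `(⋀ M₀)[z^{-1}]`. -/
def extendHS (D : ExtM0 →ₐ[ℤ] Polynomial ExtM0) : Polynomial ExtM0 →+* Polynomial ExtM0 :=
  Polynomial.eval₂RingHom' (D : ExtM0 →+* Polynomial ExtM0) Polynomial.X
    fun _ => (Polynomial.commute_X _).symm

theorem extendHS_monomial (D : ExtM0 →ₐ[ℤ] Polynomial ExtM0) (k : ℕ) (a : ExtM0) :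
    extendHS D (Polynomial.monomial k a) = D a * Polynomial.X ^ k :=
  Polynomial.eval₂_monomial _ _

theorem toEndSeries_mul (D D' : ExtM0 →ₐ[ℤ] Polynomial ExtM0) (hDD : ∀ j : ℕ,
    extendHS D (D' (ExteriorAlgebra.ι ℤ (b j))) = Polynomial.C (ExteriorAlgebra.ι ℤ (b j))) :
    toEndSeries D * toEndSeries D' = 1 := by
  have h1 : (extendHS D).toIntAlgHom.comp D' = Polynomial.CAlgHom := by
    apply ExteriorAlgebra.hom_ext
    refine Finsupp.lhom_ext' fun j => LinearMap.ext_ring ?_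
    have h2 := hDD j
    simp only [b, Int.natCast_nonneg, if_true, Int.toNat_natCast] at h2
    exact h2
  ext1 n
  refine LinearMap.ext fun x => ?_
  rw [PowerSeries.coeff_mul, LinearMap.sum_apply]
  have h2 : extendHS D (D' x) = Polynomial.C x := congrArg (fun f : ExtM0 →ₐ[ℤ] Polynomial ExtM0 => f x) h1
  have h3 : ∀ P, (extendHS D P).coeff n = ∑ y ∈ Finset.HasAntidiagonal.antidiagonal n, (D (P.coeff y.2)).coeff y.1 := by
    intro P
    induction P using Polynomial.induction_on' with
    | add P Q hP hQ => simp [map_add, hP, hQ, Finset.sum_add_distrib]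
    | monomial k a =>
      rw [extendHS_monomial, Polynomial.coeff_mul_X_pow']
      simp_rw [Polynomial.coeff_monomial]
      split_ifs with hk
      · rw [Finset.sum_eq_single (n - k, k)]
        · simp
        · rintro ⟨i, j⟩ hij hne
          rw [Finset.HasAntidiagonal.mem_antidiagonal] at hij
          simp only at hij ⊢
          rw [if_neg]
          · simp
          · rintro rfl
            exact hne (by simp; omega)
        · intro hnot
          exact absurd (by simp; omega) hnot
      · symm
        apply Finset.sum_eq_zero
        rintro ⟨i, j⟩ hij
        rw [Finset.HasAntidiagonal.mem_antidiagonal] at hij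
        simp only at hij ⊢
        rw [if_neg (by omega)]
        simp
  have h4 := h3 (D' x)
  rw [h2, Polynomial.coeff_C] at h4
  simp only [toEndSeries, PowerSeries.coeff_mk, Module.End.mul_apply, PowerSeries.coeff_one]
  change ∑ y ∈ Finset.HasAntidiagonal.antidiagonal n, (D ((D' x).coeff y.2)).coeff y.1 = _
  rw [← h4]
  split_ifs <;> rfl

theorem sigmaMinus_b (j : ℕ) : sigmaMinus (ExteriorAlgebra.ι ℤ (b j)) =
    ∑ i ∈ Finset.range (j + 1), Polynomial.monomial i (ExteriorAlgebra.ι ℤ (b (j - i))) :=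
  hsDerivation_b _ _ _

theorem sigmaBarMinus_b (j : ℕ) : sigmaBarMinus (ExteriorAlgebra.ι ℤ (b j)) =
    Polynomial.C (ExteriorAlgebra.ι ℤ (b j)) -
      Polynomial.monomial 1 (ExteriorAlgebra.ι ℤ (b ((j : ℤ) - 1))) :=
  hsDerivation_b _ _ _

theorem sigmaMinus_b_zero : sigmaMinus (ExteriorAlgebra.ι ℤ (b 0)) =
    Polynomial.C (ExteriorAlgebra.ι ℤ (b 0)) := by
  simpa using sigmaMinus_b 0

theorem sigmaMinus_b_succ (j : ℕ) : sigmaMinus (ExteriorAlgebra.ι ℤ (b ((j : ℤ) + 1))) =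
    Polynomial.C (ExteriorAlgebra.ι ℤ (b ((j : ℤ) + 1))) +
      sigmaMinus (ExteriorAlgebra.ι ℤ (b j)) * Polynomial.X := by
  have h1 := sigmaMinus_b (j + 1)
  rw [Finset.sum_range_succ'] at h1
  push_cast at h1
  rw [h1, sigmaMinus_b, Finset.sum_mul, add_comm]
  congr 1
  refine Finset.sum_congr rfl fun i _ => ?_
  rw [Polynomial.monomial_mul_X]
  congr 3
  ring

theorem sigmaBarMinus_mul_sigmaMinus : toEndSeries sigmaBarMinus * toEndSeries sigmaMinus = 1 := by
  apply toEndSeries_mul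
  intro j
  have hC : ∀ x, extendHS sigmaBarMinus (Polynomial.C x) = sigmaBarMinus x := fun x => by
    simpa using extendHS_monomial sigmaBarMinus 0 x
  have hX : extendHS sigmaBarMinus Polynomial.X = Polynomial.X := by
    rw [← Polynomial.monomial_one_one_eq_X, extendHS_monomial, map_one, one_mul, pow_one]
    exact Polynomial.monomial_one_one_eq_X.symm
  induction j with
  | zero =>
    have h1 := sigmaBarMinus_b 0
    have h2 : b (-1) = 0 := by simp [b]
    simp only [Nat.cast_zero, zero_sub, h2, map_zero, sub_zero] at h1
    rw [Nat.cast_zero, sigmaMinus_b_zero, hC, h1]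
  | succ j ih =>
    have h1 := sigmaBarMinus_b (j + 1)
    push_cast at h1 ⊢
    rw [add_sub_cancel_right] at h1
    rw [sigmaMinus_b_succ, map_add, map_mul, ih, hC, hX, h1, Polynomial.C_mul_X_eq_monomial,
      sub_add_cancel]

theorem sigmaMinus_mul_sigmaBarMinus : toEndSeries sigmaMinus * toEndSeries sigmaBarMinus = 1 := by
  apply toEndSeries_mul
  intro j
  have hC : ∀ x, extendHS sigmaMinus (Polynomial.C x) = sigmaMinus x := fun x => by
    simpa using extendHS_monomial sigmaMinus 0 x
  rw [sigmaBarMinus_b, map_sub, extendHS_monomial, hC, pow_one]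
  rcases j with _ | j
  · have h2 : b (-1) = 0 := by simp [b]
    simp only [Nat.cast_zero, zero_sub, h2, map_zero, zero_mul, sub_zero]
    exact sigmaMinus_b_zero
  · push_cast
    rw [add_sub_cancel_right, sigmaMinus_b_succ, add_sub_cancel_right]

/-- An operator `D(z)` on `⋀ M₀` that preserves the degrees, regarded as a map `B_r → B_r[z^{-1}]`
through `φ_r`: its value at `p` is `φ_r^{-1}(D(z) φ_r(p))`. -/
def transport (r : ℕ) (D : ExtM0 →ₐ[ℤ] Polynomial ExtM0)
    (hD : ∀ x ∈ ⋀[ℤ]^r M0, CoeffsIn (⋀[ℤ]^r M0) (D x)) (p : B r) : Polynomial (B r) :=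
  ∑ i ∈ (D (phi r p : ExtM0)).support,
    Polynomial.monomial i ((phi r).symm ⟨(D (phi r p : ExtM0)).coeff i, hD _ (phi r p).2 i⟩)

/-- `σ_-(z) : B_r → B_r[z^{-1}]`. -/
def sigmaMinusB (r : ℕ) (p : B r) : Polynomial (B r) :=
  transport r sigmaMinus (fun _ hx => hsDerivation_coeff_mem _ _ r hx) p

/-- `σ̄_-(z) : B_r → B_r[z^{-1}]`. -/
def sigmaBarMinusB (r : ℕ) (p : B r) : Polynomial (B r) :=
  transport r sigmaBarMinus (fun _ hx => hsDerivation_coeff_mem _ _ r hx) p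

/-- The sequence `σ_-(z) H_r = (σ_-(z) h_n)`. For `r = 0`, where `h_n = 0` for `n > 0`, its `n`-th
term is by convention `z^{-n}` for `n ≥ 0`, and `0` for `n < 0`. -/
def sigmaMinusH (r : ℕ) (n : ℤ) : Polynomial (B r) :=
  if r = 0 then (if 0 ≤ n then Polynomial.X ^ n.toNat else 0) else sigmaMinusB r (h r n)

/-! ### Laurent series and residues -/

/-- The inclusion `R[z^{-1}] → R((z))`; the variable of the polynomials is `z^{-1}`. -/
def invLaurent {R : Type*} [CommRing R] : Polynomial R →+* LaurentSeries R :=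
  Polynomial.eval₂RingHom HahnSeries.C (HahnSeries.single (-1) 1)

/-- `f(z) ⊗ g(z) = ∑ (f_i ⊗ g_j) z^{i+j}`, a Laurent series over `R ⊗ S`. -/
def tensorSeries {R S : Type*} [CommRing R] [CommRing S] (f : LaurentSeries R)
    (g : LaurentSeries S) : LaurentSeries (R ⊗[ℤ] S) :=
  f.map (Algebra.TensorProduct.includeLeft : R →ₐ[ℤ] R ⊗[ℤ] S) *
    g.map (Algebra.TensorProduct.includeRight : S →ₐ[ℤ] R ⊗[ℤ] S)

/-- The residue: the coefficient of `z^{-1}`. -/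
def res {R : Type*} [CommRing R] (f : LaurentSeries R) : R := f.coeff (-1)

end

end SchubertCone

open SchubertCone

/-!
Two facts are combined.

*Plücker form.* An element `m` of `⋀ʳ M₀` is a pure wedge if and only if
`∑ᵢ (bᵢ^* ⌋ m) ⊗ (bᵢ ∧ m) = 0`. For the nontrivial direction, comparing coefficients in the first
factor gives `u ∧ m = 0` for some `u ≠ 0`, and over a principal ideal domain `u` can be divided by
its content; then `m = u ∧ (f ⌋ m)` for a linear form `f` with `f u = 1`, and `f ⌋ m` satisfies the
same relation. In degree zero a scalar is left, which one of the vectors absorbs.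

*Residue.* Let `f₀ < ⋯ < f_{r-1}` be the indices with `[b]_λ = b_{f₀} ∧ ⋯ ∧ b_{f_{r-1}}`. Row
operations on determinants turn `E_{r-1}(z) Δ_λ(σ_-(z) H_{r-1})` into a sum of terms
`± z^{r-1-f_j} Δ`, where `φ_{r-1}` carries `Δ` to `[b]_λ` with `b_{f_j}` removed, and
`σ̄_-(z) Δ_μ(H_{r+1}) / E_{r+1}(z)` into a series whose coefficient at `z^{i-r}` corresponds to
`± b_i ∧ [b]_μ`. The residue pairs the exponents `r - 1 - f_j` and `f_j - r`, which makes it minus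
the Plücker form.
-/

namespace SchubertCone

noncomputable section

/-! ### The Plücker form of an exterior algebra -/

section PluckerForm

open ExteriorAlgebra TensorProduct

variable {R M : Type*} [CommRing R] [AddCommGroup M] [Module R M]

/-- The recursion step `(v, (x, y)) ↦ x ⊗ v - (v ∧ ·) y` defining `polarization`. -/
def polarizationAux :
    M →ₗ[R] ExteriorAlgebra R M × (ExteriorAlgebra R M ⊗[R] M) →ₗ[R] ExteriorAlgebra R M ⊗[R] M :=
  LinearMap.mk₂ R (fun v p => p.1 ⊗ₜ v - (LinearMap.mul R _ (ι R v)).rTensor M p.2)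
    (fun v w p => by
      simp only [TensorProduct.tmul_add, map_add, LinearMap.rTensor_add, LinearMap.add_apply]
      abel)
    (fun c v p => by
      simp only [TensorProduct.tmul_smul, map_smul, smul_sub, LinearMap.rTensor_smul,
        LinearMap.smul_apply])
    (fun v p q => by
      simp only [Prod.fst_add, Prod.snd_add, TensorProduct.add_tmul, map_add]
      abel)
    (fun c v p => by
      simp only [Prod.smul_fst, Prod.smul_snd, TensorProduct.smul_tmul', map_smul, smul_sub])

theorem polarizationAux_apply (v : M) (x : ExteriorAlgebra R M) (y : ExteriorAlgebra R M ⊗[R] M) :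
    polarizationAux v (x, y) = x ⊗ₜ v - (LinearMap.mulLeft R (ι R v)).rTensor M y :=
  rfl

theorem polarizationAux_polarizationAux (v : M) (x : ExteriorAlgebra R M)
    (y : ExteriorAlgebra R M ⊗[R] M) :
    polarizationAux v (ι R v * x, polarizationAux v (x, y)) = 0 := by
  have mulLeft_mulLeft : (LinearMap.mulLeft R (ι R v)).rTensor M
      ((LinearMap.mulLeft R (ι R v)).rTensor M y) = 0 := by
    rw [← LinearMap.rTensor_comp_apply, ← LinearMap.mulLeft_mul,
      ι_sq_zero, LinearMap.mulLeft_zero_eq_zero, LinearMap.rTensor_zero, LinearMap.zero_apply]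
  simp [polarizationAux_apply, mulLeft_mulLeft]

/-- The component of the comultiplication of the exterior algebra whose second factor has degree
one: `v₀ ∧ ⋯ ∧ vₙ ↦ ∑ⱼ (-1)ʲ (v₀ ∧ ⋯ v̂ⱼ ⋯ ∧ vₙ) ⊗ vⱼ`. For a basis `(bᵢ)` of `M` it sends `x` to
`∑ᵢ (bᵢ^* ⌋ x) ⊗ bᵢ`. -/
def polarization : ExteriorAlgebra R M →ₗ[R] ExteriorAlgebra R M ⊗[R] M :=
  CliffordAlgebra.foldr' (0 : QuadraticForm R M) polarizationAux
    (fun v x y => (polarizationAux_polarizationAux v x y).trans (zero_smul R y).symm) 0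

theorem polarization_algebraMap (c : R) :
    polarization (algebraMap R (ExteriorAlgebra R M) c) = 0 :=
  (CliffordAlgebra.foldr'_algebraMap _ _ _ _ c).trans (smul_zero c)

theorem polarization_ι_mul (v : M) (x : ExteriorAlgebra R M) :
    polarization (ι R v * x) =
      x ⊗ₜ v - (LinearMap.mulLeft R (ι R v)).rTensor M (polarization x) :=
  CliffordAlgebra.foldr'_ι_mul _ _ _ _ v x

theorem polarization_ιMulti (n : ℕ) (v : Fin (n + 1) → M) :
    polarization (ιMulti R (n + 1) v) =
      ∑ j : Fin (n + 1), (-1 : ℤ) ^ (j : ℕ) • (ιMulti R n (v ∘ j.succAbove) ⊗ₜ[R] v j) := by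
  induction n with
  | zero =>
    have polarization_one : polarization (1 : ExteriorAlgebra R M) = 0 := by
      simpa using polarization_algebraMap (M := M) (1 : R)
    simp [ιMulti_succ_apply, polarization_ι_mul, polarization_one, -mul_one]
  | succ n ih =>
    rw [ιMulti_succ_apply, polarization_ι_mul, ih, Fin.sum_univ_succ (n := n + 1), map_sum,
      sub_eq_add_neg, ← Finset.sum_neg_distrib]
    congr 1
    · simp [Matrix.vecTail, Function.comp_def]
    · refine Finset.sum_congr rfl fun j _ => ?_
      rw [map_zsmul, LinearMap.rTensor_tmul, LinearMap.mulLeft_apply, ιMulti_succ_apply,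
        Fin.val_succ, pow_succ, mul_neg_one, neg_smul]
      simp only [Matrix.vecTail, Function.comp_def, Fin.succ_succAbove_zero,
        Fin.succ_succAbove_succ]

/-- Contraction of the exterior algebra by a linear form. -/
def contract (d : Module.Dual R M) : ExteriorAlgebra R M →ₗ[R] ExteriorAlgebra R M :=
  CliffordAlgebra.contractLeft (Q := (0 : QuadraticForm R M)) d

theorem contract_algebraMap (d : Module.Dual R M) (c : R) :
    contract d (algebraMap R (ExteriorAlgebra R M) c) = 0 :=
  CliffordAlgebra.contractLeft_algebraMap _ _ _

theorem contract_ι_mul (d : Module.Dual R M) (v : M) (x : ExteriorAlgebra R M) :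
    contract d (ι R v * x) = d v • x - ι R v * contract d x :=
  CliffordAlgebra.contractLeft_ι_mul _ _ _

theorem contract_contract (d : Module.Dual R M) (x : ExteriorAlgebra R M) :
    contract d (contract d x) = 0 :=
  CliffordAlgebra.contractLeft_contractLeft _ _

theorem rid_lTensor_polarization (d : Module.Dual R M) (x : ExteriorAlgebra R M) :
    TensorProduct.rid R _ (d.lTensor _ (polarization x)) = contract d x := by
  induction x using CliffordAlgebra.left_induction with
  | algebraMap c =>
    refine (congrArg _ (congrArg _ (polarization_algebraMap c))).trans ?_
    rw [map_zero, map_zero]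
    exact (contract_algebraMap d c).symm
  | add x y hx hy => simp only [map_add, hx, hy]
  | ι_mul x v hx =>
    refine (congrArg _ (congrArg _ (polarization_ι_mul v x))).trans
      (Eq.trans ?_ (contract_ι_mul d v x).symm)
    rw [← hx, map_sub, map_sub, LinearMap.lTensor_tmul, TensorProduct.rid_tmul]
    congr 1
    induction polarization x using TensorProduct.induction_on with
    | zero => simp
    | tmul y u => simp
    | add y z hy hz => simp only [map_add, mul_add, hy, hz]

theorem contract_mem_exteriorPower (d : Module.Dual R M) (n : ℕ) {x : ExteriorAlgebra R M}
    (hx : x ∈ ⋀[R]^(n + 1) M) : contract d x ∈ ⋀[R]^n M := by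
  suffices h : ⋀[R]^(n + 1) M ≤ (⋀[R]^n M).comap (contract d) from h hx
  rw [← ιMulti_span_fixedDegree, Submodule.span_le]
  rintro _ ⟨v, rfl⟩
  rw [SetLike.mem_coe, Submodule.mem_comap, ← rid_lTensor_polarization, polarization_ιMulti,
    map_sum, map_sum]
  refine Submodule.sum_mem _ fun j _ => ?_
  rw [map_zsmul, map_zsmul, LinearMap.lTensor_tmul, TensorProduct.rid_tmul]
  exact zsmul_mem (Submodule.smul_mem _ _ (ιMulti_range R n ⟨_, rfl⟩)) _

theorem polarization_contract (d : Module.Dual R M) (x : ExteriorAlgebra R M) :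
    polarization (contract d x) = -(contract d).rTensor M (polarization x) := by
  induction x using CliffordAlgebra.left_induction with
  | algebraMap c =>
    refine (congrArg _ (contract_algebraMap d c)).trans ?_
    refine Eq.trans ?_ (congrArg _ (congrArg _ (polarization_algebraMap c))).symm
    simp only [map_zero, neg_zero]
  | add x y hx hy => simp only [map_add, hx, hy, neg_add]
  | ι_mul x v hx =>
    refine (congrArg _ (contract_ι_mul d v x)).trans ?_
    refine Eq.trans ?_ (congrArg _ (congrArg _ (polarization_ι_mul v x))).symm
    rw [map_sub, map_smul, polarization_ι_mul, hx, map_sub, map_neg, LinearMap.rTensor_tmul]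
    suffices h : (contract d).rTensor M ((LinearMap.mulLeft R (ι R v)).rTensor M (polarization x)) =
        d v • polarization x -
          (LinearMap.mulLeft R (ι R v)).rTensor M ((contract d).rTensor M (polarization x)) by
      rw [h]
      abel
    induction polarization x using TensorProduct.induction_on with
    | zero => simp
    | tmul y u => simp [contract_ι_mul, TensorProduct.sub_tmul, TensorProduct.smul_tmul']
    | add y z hy hz =>
      simp only [map_add, smul_add, hy, hz]
      abel

/-- The map `x ⊗ v ↦ v ∧ x`. -/
def wedgeBack : ExteriorAlgebra R M ⊗[R] M →ₗ[R] ExteriorAlgebra R M :=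
  TensorProduct.lift (LinearMap.mul R (ExteriorAlgebra R M) ∘ₗ ι R).flip

theorem wedgeBack_tmul (x : ExteriorAlgebra R M) (v : M) : wedgeBack (x ⊗ₜ[R] v) = ι R v * x :=
  rfl

theorem wedgeBack_polarization (n : ℕ) {x : ExteriorAlgebra R M} (hx : x ∈ ⋀[R]^n M) :
    wedgeBack (polarization x) = n • x := by
  induction hx using Submodule.pow_induction_on_left' with
  | algebraMap c => rw [polarization_algebraMap, map_zero, zero_smul]
  | add x y i _ _ hx hy => rw [map_add, map_add, hx, hy, smul_add]
  | mem_mul v hv i x _ ih =>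
    obtain ⟨v, rfl⟩ := hv
    have wedgeBack_mulLeft (y : ExteriorAlgebra R M ⊗[R] M) :
        wedgeBack ((LinearMap.mulLeft R (ι R v)).rTensor M y) = -(ι R v * wedgeBack y) := by
      induction y using TensorProduct.induction_on with
      | zero => simp
      | tmul y u =>
        simp only [LinearMap.rTensor_tmul, LinearMap.mulLeft_apply, wedgeBack_tmul, ← mul_assoc,
          ← neg_mul, eq_neg_of_add_eq_zero_left (ι_add_mul_swap u v)]
      | add y z hy hz => simp only [map_add, mul_add, neg_add, hy, hz]
    rw [polarization_ι_mul, map_sub, wedgeBack_tmul, wedgeBack_mulLeft, ih, sub_neg_eq_add,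
      mul_smul_comm, succ_nsmul']

/-- The Plücker form `(x, y) ↦ ∑ᵢ (bᵢ^* ⌋ x) ⊗ (bᵢ ∧ y)`, where `(bᵢ)` is any basis of `M`. -/
def plucker : ExteriorAlgebra R M →ₗ[R] ExteriorAlgebra R M →ₗ[R]
    ExteriorAlgebra R M ⊗[R] ExteriorAlgebra R M :=
  (LinearMap.lTensorHom (ExteriorAlgebra R M) ∘ₗ
    (LinearMap.mul R (ExteriorAlgebra R M) ∘ₗ ι R).flip).flip ∘ₗ polarization

theorem plucker_apply (x y : ExteriorAlgebra R M) :
    plucker x y = ((LinearMap.mul R (ExteriorAlgebra R M) ∘ₗ ι R).flip y).lTensor _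
      (polarization x) :=
  rfl

theorem plucker_ιMulti (n : ℕ) (v : Fin (n + 1) → M) (y : ExteriorAlgebra R M) :
    plucker (ιMulti R (n + 1) v) y = ∑ j : Fin (n + 1),
      (-1 : ℤ) ^ (j : ℕ) • (ιMulti R n (v ∘ j.succAbove) ⊗ₜ[R] (ι R (v j) * y)) := by
  rw [plucker_apply, polarization_ιMulti, map_sum]
  exact Finset.sum_congr rfl fun j _ => map_zsmul _ _ _

theorem plucker_ιMulti_self (n : ℕ) (v : Fin (n + 1) → M) :
    plucker (ιMulti R (n + 1) v) (ιMulti R (n + 1) v) = 0 := by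
  rw [plucker_ιMulti]
  refine Finset.sum_eq_zero fun j _ => ?_
  rw [ιMulti_apply (v := v), ι_mul_prod_list, TensorProduct.tmul_zero, smul_zero]

theorem plucker_contract_left (d : Module.Dual R M) (x y : ExteriorAlgebra R M) :
    plucker (contract d x) y = -(contract d).rTensor _ (plucker x y) := by
  rw [plucker_apply, plucker_apply, polarization_contract, map_neg]
  congr 1
  induction polarization x using TensorProduct.induction_on with
  | zero => simp
  | tmul z u => rfl
  | add z w hz hw => simp only [map_add, hz, hw]

theorem plucker_contract_right (d : Module.Dual R M) (x y : ExteriorAlgebra R M) :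
    plucker x (contract d y) =
      contract d x ⊗ₜ y - (contract d).lTensor _ (plucker x y) := by
  rw [plucker_apply, plucker_apply, ← rid_lTensor_polarization d x]
  induction polarization x using TensorProduct.induction_on with
  | zero => simp
  | tmul z u => simp [contract_ι_mul, TensorProduct.tmul_sub, TensorProduct.smul_tmul]
  | add z w hz hw =>
    simp only [map_add, TensorProduct.add_tmul, hz, hw]
    abel

theorem plucker_contract (d : Module.Dual R M) (x y : ExteriorAlgebra R M) :
    plucker (contract d x) (contract d y) =
      TensorProduct.map (contract d) (contract d) (plucker x y) := by
  rw [plucker_contract_right, contract_contract, TensorProduct.zero_tmul, zero_sub,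
    plucker_contract_left, map_neg, neg_neg, ← LinearMap.comp_apply,
    LinearMap.lTensor_comp_rTensor]

instance [Module.Free R M] : Module.Free R (ExteriorAlgebra R M) := by
  classical
  let _ : LinearOrder (Module.Free.ChooseBasisIndex R M) := linearOrderOfSTO WellOrderingRel
  exact Module.Free.of_basis (Module.Free.chooseBasis R M).ExteriorAlgebra

theorem exists_ι_mul_eq_zero [IsDomain R] [CharZero R] [Module.Free R M] (n : ℕ)
    {x : ExteriorAlgebra R M} (hx : x ∈ ⋀[R]^(n + 1) M) (hx0 : x ≠ 0) (hp : plucker x x = 0) :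
    ∃ u : M, u ≠ 0 ∧ ι R u * x = 0 := by
  have polarization_ne_zero : polarization x ≠ 0 := by
    intro h0
    have euler := wedgeBack_polarization (n + 1) hx
    rw [h0, map_zero, ← Nat.cast_smul_eq_nsmul R] at euler
    exact smul_ne_zero (Nat.cast_ne_zero.mpr n.succ_ne_zero) hx0 euler.symm
  let basis := Module.Free.chooseBasis R (ExteriorAlgebra R M)
  obtain ⟨i, hi⟩ := Finsupp.ne_iff.mp
    ((TensorProduct.equivFinsuppOfBasisLeft basis).map_ne_zero_iff.mpr polarization_ne_zero)
  refine ⟨_, hi, ?_⟩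
  have h := congrArg (fun t => TensorProduct.equivFinsuppOfBasisLeft basis t i) hp
  simp only [plucker_apply, map_zero, Finsupp.zero_apply] at h
  rw [← h]
  induction polarization x using TensorProduct.induction_on with
  | zero => simp
  | tmul y u => simp
  | add y z hy hz => simp [add_mul, hy, hz]

theorem exists_primitive [IsDomain R] [IsPrincipalIdealRing R] [Module.Free R M] {u : M}
    (hu : u ≠ 0) : ∃ (w : M) (f : Module.Dual R M) (g : R), g ≠ 0 ∧ u = g • w ∧ f w = 1 := by
  let basis := Module.Free.chooseBasis R M
  obtain ⟨g, hg⟩ := IsPrincipalIdealRing.principal (LinearMap.range (Module.Dual.eval R M u))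
  obtain ⟨f, hf⟩ : g ∈ LinearMap.range (Module.Dual.eval R M u) :=
    hg ▸ Submodule.mem_span_singleton_self g
  have dvd_coord (i) : g ∣ basis.repr u i := by
    rw [← Ideal.mem_span_singleton, Ideal.span, ← hg]
    exact ⟨basis.coord i, rfl⟩
  choose c hc using dvd_coord
  have hg0 : g ≠ 0 := by
    rintro rfl
    refine hu (basis.repr.map_eq_zero_iff.mp (Finsupp.ext fun i => ?_))
    rw [hc, zero_mul, Finsupp.zero_apply]
  let w : M := basis.repr.symm
    (Finsupp.onFinset (basis.repr u).support c fun i hi => by simp [hc, hg0, hi])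
  have hw : u = g • w := by
    rw [← basis.repr.injective.eq_iff, map_smul, LinearEquiv.apply_symm_apply]
    exact Finsupp.ext hc
  refine ⟨w, f, g, hg0, hw, mul_left_cancel₀ hg0 ?_⟩
  rw [mul_one, ← smul_eq_mul, ← map_smul, ← hw]
  exact hf

theorem exists_smul_ιMulti_of_plucker_eq_zero [IsDomain R] [IsPrincipalIdealRing R] [CharZero R]
    [Module.Free R M] (n : ℕ) {x : ExteriorAlgebra R M} (hx : x ∈ ⋀[R]^n M)
    (hp : plucker x x = 0) : ∃ (c : R) (v : Fin n → M), x = c • ιMulti R n v := by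
  induction n generalizing x with
  | zero =>
    obtain ⟨c, rfl⟩ := Submodule.mem_one.mp (by rwa [exteriorPower, pow_zero] at hx)
    exact ⟨c, 0, by rw [ιMulti_zero_apply, Algebra.algebraMap_eq_smul_one]⟩
  | succ n ih =>
    by_cases hx0 : x = 0
    · exact ⟨0, 0, by rw [hx0, zero_smul]⟩
    obtain ⟨u, hu0, hu⟩ := exists_ι_mul_eq_zero n hx hx0 hp
    obtain ⟨w, f, g, hg0, rfl, hfw⟩ := exists_primitive (R := R) hu0
    have hw : ι R w * x = 0 := by
      rw [map_smul, smul_mul_assoc] at hu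
      exact (smul_eq_zero.mp hu).resolve_left hg0
    have x_eq : x = ι R w * contract f x := by
      have h := contract_ι_mul f w x
      rwa [hw, map_zero, hfw, one_smul, eq_comm, sub_eq_zero] at h
    obtain ⟨c, v, hv⟩ := ih (contract_mem_exteriorPower f n hx)
      (by rw [plucker_contract, hp, map_zero])
    refine ⟨c, Matrix.vecCons w v, ?_⟩
    rw [x_eq, hv, ιMulti_succ_apply, mul_smul_comm, Matrix.cons_val_zero, Matrix.tail_cons]

theorem mem_range_ιMulti_iff_plucker_eq_zero [IsDomain R] [IsPrincipalIdealRing R] [CharZero R]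
    [Module.Free R M] (n : ℕ) {x : ExteriorAlgebra R M} (hx : x ∈ ⋀[R]^(n + 1) M) :
    x ∈ Set.range (ιMulti R (n + 1) (M := M)) ↔ plucker x x = 0 := by
  constructor
  · rintro ⟨v, rfl⟩
    exact plucker_ιMulti_self n v
  · intro hp
    obtain ⟨c, v, rfl⟩ := exists_smul_ιMulti_of_plucker_eq_zero (n + 1) hx hp
    exact ⟨Function.update v 0 (c • v 0), by
      rw [AlternatingMap.map_update_smul, Function.update_eq_self]⟩

end PluckerForm

theorem mem_grassmannCone_iff (n : ℕ) (m : ⋀[ℤ]^(n + 1) M0) :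
    m ∈ grassmannCone (n + 1) ↔ plucker (m : ExtM0) (m : ExtM0) = 0 := by
  rw [← mem_range_ιMulti_iff_plucker_eq_zero n m.2]
  simp only [grassmannCone, Set.mem_range, Subtype.ext_iff, exteriorPower.ιMulti_apply_coe]

/-! ### Schubert derivations as determinants -/

section DetFunctional

variable {R M A : Type*} [CommRing R] [AddCommGroup M] [Module R M] [CommRing A] [Algebra R A]
  {s : ℕ}

/-- The alternating map `(m₁, …, m_s) ↦ det (c(m₁), …, c(m_s))` defined by a coordinate map `c`. -/
def detAlternating (c : M →ₗ[R] Fin s → A) : M [⋀^Fin s]→ₗ[R] A :=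
  { (Matrix.detRowAlternating.toMultilinearMap.restrictScalars R).compLinearMap fun _ => c with
    map_eq_zero_of_eq' := fun v _ _ hij hne =>
      Matrix.detRowAlternating.map_eq_zero_of_eq (fun k => c (v k)) (congrArg c hij) hne }

theorem detAlternating_apply (c : M →ₗ[R] Fin s → A) (m : Fin s → M) :
    detAlternating c m = Matrix.det (Matrix.of fun k => c (m k)) :=
  rfl

/-- The functional `m₁ ∧ ⋯ ∧ m_s ↦ det (c(m₁), …, c(m_s))`, extended by zero from the `s`-th
exterior power to the whole exterior algebra. -/
def detFunctional (c : M →ₗ[R] Fin s → A) : ExteriorAlgebra R M →ₗ[R] A :=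
  ExteriorAlgebra.liftAlternating (Pi.single s (detAlternating c))

theorem detFunctional_ιMulti (c : M →ₗ[R] Fin s → A) (m : Fin s → M) :
    detFunctional c (ExteriorAlgebra.ιMulti R s m) = Matrix.det (Matrix.of fun k => c (m k)) := by
  rw [detFunctional, ExteriorAlgebra.liftAlternating_apply_ιMulti, Pi.single_eq_same,
    detAlternating_apply]

/-- The map `∑ₙ mₙ Xⁿ ↦ ∑ₙ g(mₙ) Xⁿ`, where finitely supported functions encode the polynomials
with coefficients in a module. -/
def polyMap {S : Type*} [Semiring S] [Algebra R S] (g : M →ₗ[R] S) :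
    (ℕ →₀ M) →ₗ[R] Polynomial S :=
  Finsupp.lsum R fun n => (Polynomial.monomial n).restrictScalars R ∘ₗ g

theorem polyMap_single {S : Type*} [Semiring S] [Algebra R S] (g : M →ₗ[R] S) (n : ℕ) (m : M) :
    polyMap g (Finsupp.single n m) = Polynomial.monomial n (g m) := by
  simp [polyMap]

theorem prod_ofFn_monomial {S : Type*} [Semiring S] (n : Fin s → ℕ) (a : Fin s → S) :
    (List.ofFn fun k => Polynomial.monomial (n k) (a k)).prod =
      Polynomial.monomial (∑ k, n k) (List.ofFn a).prod := by
  induction s with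
  | zero => simp
  | succ s ih => simp [List.ofFn_succ, ih, Polynomial.monomial_mul_monomial, Fin.sum_univ_succ]

theorem det_monomial (n : Fin s → ℕ) (a : Matrix (Fin s) (Fin s) A) :
    Matrix.det (Matrix.of fun k l => Polynomial.monomial (n k) (a k l)) =
      Polynomial.monomial (∑ k, n k) a.det := by
  calc _ = Matrix.det (Matrix.of fun k l => Polynomial.X ^ n k * a.map Polynomial.C k l) := by
        simp only [← Polynomial.C_mul_X_pow_eq_monomial, Polynomial.X_pow_mul, Matrix.map_apply]
    _ = (∏ k, Polynomial.X ^ n k) * (a.map Polynomial.C).det := Matrix.det_mul_column _ _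
    _ = Polynomial.monomial (∑ k, n k) a.det := by
      rw [Finset.prod_pow_eq_pow_sum, ← RingHom.mapMatrix_apply, ← RingHom.map_det,
        Polynomial.X_pow_mul, Polynomial.C_mul_X_pow_eq_monomial]

theorem detFunctional_coeff_prod_single (c : M →ₗ[R] Fin s → A) (i : Fin s → ℕ) (m : Fin s → M)
    (n : ℕ) :
    detFunctional c ((List.ofFn fun k =>
        polyMap (ExteriorAlgebra.ι R) (Finsupp.single (i k) (m k))).prod.coeff n) =
      (Matrix.det (Matrix.of fun k l =>
        polyMap (LinearMap.proj l ∘ₗ c) (Finsupp.single (i k) (m k)))).coeff n := by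
  simp only [polyMap_single, LinearMap.comp_apply, LinearMap.proj_apply]
  rw [prod_ofFn_monomial, det_monomial i fun k => c (m k), Polynomial.coeff_monomial,
    Polynomial.coeff_monomial, apply_ite (detFunctional c), map_zero,
    ← ExteriorAlgebra.ιMulti_apply, detFunctional_ιMulti]
  rfl

theorem detFunctional_coeff_prod [Module.Free R M] (c : M →ₗ[R] Fin s → A) (Q : Fin s → ℕ →₀ M)
    (n : ℕ) :
    detFunctional c ((List.ofFn fun k => polyMap (ExteriorAlgebra.ι R) (Q k)).prod.coeff n) =
      (Matrix.det (Matrix.of fun k l => polyMap (LinearMap.proj l ∘ₗ c) (Q k))).coeff n := by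
  let wedgeSide : MultilinearMap R (fun _ : Fin s => ℕ →₀ M) A :=
    (detFunctional c ∘ₗ (Polynomial.lcoeff (ExteriorAlgebra R M) n).restrictScalars
      R).compMultilinearMap ((MultilinearMap.mkPiAlgebraFin R s _).compLinearMap
        fun _ => polyMap (ExteriorAlgebra.ι R))
  let detSide : MultilinearMap R (fun _ : Fin s => ℕ →₀ M) A :=
    ((Polynomial.lcoeff A n).restrictScalars R).compMultilinearMap
      ((Matrix.detRowAlternating.toMultilinearMap.restrictScalars R).compLinearMap
        fun _ => LinearMap.pi fun l => polyMap (LinearMap.proj l ∘ₗ c))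
  suffices h : wedgeSide = detSide from MultilinearMap.congr_fun h Q
  refine Module.Basis.ext_multilinear
    (fun _ => Finsupp.basis fun _ => Module.Free.chooseBasis R M) fun v => ?_
  simp only [Finsupp.coe_basis]
  exact detFunctional_coeff_prod_single c (fun k => (v k).1)
    (fun k => Module.Free.chooseBasis R M (v k).2) n

end DetFunctional

/-- The determinant `det (G_{f_k - l})`, with `l` the row and `k` the column: for `f` the increasing
sequence `lam.index` it is the Schur determinant of `lam`. -/
def indexDet {R : Type*} [CommRing R] {s : ℕ} (G : ℤ → R) (f : Fin s → ℕ) : R :=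
  Matrix.det (Matrix.of fun l k : Fin s => G ((f k : ℤ) - (l : ℤ)))

theorem hDet_eq_indexDet (s : ℕ) (f : Fin s → ℕ) : hDet s f = indexDet (h s) f :=
  rfl

theorem schurDet_eq_indexDet {R : Type*} [CommRing R] {r : ℕ} (lam : Ptn r) (G : ℤ → R) :
    schurDet lam G = indexDet G lam.index := by
  rw [schurDet, indexDet, ← Matrix.det_submatrix_equiv_self (Fin.revPerm : Equiv.Perm (Fin r))]
  congr 1
  ext1 i j
  simp only [Matrix.submatrix_apply, Matrix.of_apply, Fin.revPerm_apply, Ptn.index]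
  congr 1
  simp only [Fin.val_rev]
  omega

theorem map_indexDet {R S : Type*} [CommRing R] [CommRing S] (g : R →+* S) {s : ℕ} (G : ℤ → R)
    (f : Fin s → ℕ) : g (indexDet G f) = indexDet (g ∘ G) f :=
  RingHom.map_det g _

theorem indexDet_hook {R : Type*} [CommRing R] {G : ℤ → R} (hG0 : G 0 = 1)
    (hG : ∀ m < 0, G m = 0) (s n : ℕ) :
    indexDet G (Fin.snoc (α := fun _ => ℕ) (fun k : Fin s => (k : ℕ)) (s + n)) = G n := by
  rw [indexDet, Matrix.det_of_isUpperTriangular]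
  · rw [Fin.prod_univ_castSucc]
    simp [hG0]
  · intro l k hkl
    replace hkl : k < l := hkl
    induction k using Fin.lastCases with
    | last => exact absurd hkl (not_lt.mpr (Fin.le_last l))
    | cast k =>
      rw [Matrix.of_apply, Fin.snoc_castSucc]
      exact hG _ (sub_neg.mpr (Int.ofNat_lt.mpr hkl))

/-- The linear map `b_j ↦ (h_{j - l})_l`, whose determinants compute `φ_s⁻¹`. -/
def hColumn (s : ℕ) : M0 →ₗ[ℤ] Fin s → B s :=
  Finsupp.linearCombination ℤ fun (j : ℕ) (l : Fin s) => h s ((j : ℤ) - (l : ℤ))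

theorem hColumn_b (s : ℕ) (j : ℤ) (l : Fin s) : hColumn s (b j) l = h s (j - (l : ℤ)) := by
  by_cases hj : 0 ≤ j
  · simp [hColumn, b, hj]
  · rw [b, if_neg hj, map_zero, Pi.zero_apply, h_neg s (by omega)]

theorem detFunctional_hColumn_ιMulti_b (s : ℕ) (f : Fin s → ℕ) :
    detFunctional (hColumn s) (ExteriorAlgebra.ιMulti ℤ s fun k => b (f k)) = hDet s f := by
  rw [detFunctional_ιMulti, hDet, ← Matrix.det_transpose]
  congr 1
  ext1 l k
  exact hColumn_b s _ _

theorem phi_symm_apply (s : ℕ) (x : ⋀[ℤ]^s M0) :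
    (phi s).symm x = detFunctional (hColumn s) (x : ExtM0) := by
  suffices h : (phi s).symm.toLinearMap = detFunctional (hColumn s) ∘ₗ Submodule.subtype _ from
    LinearMap.congr_fun h x
  refine (wedgeBasis s).ext fun lam => ?_
  rw [wedgeBasis_apply, LinearEquiv.coe_coe, ← phi_schurDet, LinearEquiv.symm_apply_apply,
    phi_schurDet, ← hDet_index, ← detFunctional_hColumn_ιMulti_b]
  rfl

theorem phi_hDet (s : ℕ) (f : Fin s → ℕ) :
    phi s (hDet s f) = exteriorPower.ιMulti ℤ s fun k => b (f k) := by
  rw [← LinearEquiv.eq_symm_apply, phi_symm_apply, exteriorPower.ιMulti_apply_coe,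
    detFunctional_hColumn_ιMulti_b]

section Transport

variable {s : ℕ} {D : ExtM0 →ₐ[ℤ] Polynomial ExtM0}
  (hD : ∀ x ∈ ⋀[ℤ]^s M0, CoeffsIn (⋀[ℤ]^s M0) (D x))

theorem coeff_transport (p : B s) (n : ℕ) :
    (transport s D hD p).coeff n = detFunctional (hColumn s) ((D (phi s p : ExtM0)).coeff n) := by
  rw [transport, Polynomial.finsetSum_coeff]
  simp_rw [Polynomial.coeff_monomial, phi_symm_apply]
  rw [Finset.sum_ite_eq']
  split_ifs with hn
  · rfl
  · rw [Polynomial.notMem_support_iff.mp hn, map_zero]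

theorem transport_hDet {c : ℕ → ℕ →₀ M0}
    (hc : ∀ j : ℕ, D (ExteriorAlgebra.ι ℤ (b j)) = polyMap (ExteriorAlgebra.ι ℤ) (c j))
    (f : Fin s → ℕ) :
    transport s D hD (hDet s f) = Matrix.det (Matrix.of fun l k : Fin s =>
      polyMap (LinearMap.proj l ∘ₗ hColumn s) (c (f k))) := by
  ext1 n
  rw [coeff_transport, phi_hDet, exteriorPower.ιMulti_apply_coe, ExteriorAlgebra.ιMulti_apply,
    map_list_prod, List.map_ofFn]
  simp only [Function.comp_def, hc]
  rw [detFunctional_coeff_prod, ← Matrix.det_transpose]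
  rfl

end Transport

theorem sigmaBarMinusB_hDet (s : ℕ) (f : Fin s → ℕ) :
    sigmaBarMinusB s (hDet s f) = indexDet
      (fun n => Polynomial.C (h s n) - Polynomial.X * Polynomial.C (h s (n - 1))) f := by
  refine (transport_hDet _
    (c := fun j => Finsupp.single 0 (b j) - Finsupp.single 1 (b ((j : ℤ) - 1))) ?_ f).trans ?_
  · intro j
    rw [sigmaBarMinus_b, map_sub, polyMap_single, polyMap_single, Polynomial.monomial_zero_left]
  · rw [indexDet]
    congr 1
    ext1 l k
    simp only [Matrix.of_apply, map_sub, polyMap_single, LinearMap.comp_apply,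
      LinearMap.proj_apply, hColumn_b, Polynomial.monomial_zero_left,
      ← Polynomial.C_mul_X_eq_monomial, Polynomial.X_mul_C, sub_right_comm]

/-- The polynomial `∑_{i ≥ 0} h_{n-i} z^{-i}` in the variable `z^{-1}`; it is `σ_-(z) h_n`, by
`sigmaMinusH_eq_hTail`. -/
def hTail (s : ℕ) (n : ℤ) : Polynomial (B s) :=
  ∑ i ∈ Finset.range (n.toNat + 1), Polynomial.monomial i (h s (n - i))

theorem coeff_hTail (s : ℕ) (n : ℤ) (i : ℕ) : (hTail s n).coeff i = h s (n - i) := by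
  rw [hTail, Polynomial.finsetSum_coeff]
  simp_rw [Polynomial.coeff_monomial]
  rw [Finset.sum_ite_eq']
  split_ifs with hi
  · rfl
  · rw [Finset.mem_range] at hi
    rw [h_neg s (by omega)]

theorem hTail_neg (s : ℕ) {n : ℤ} (hn : n < 0) : hTail s n = 0 := by
  ext1 i
  rw [coeff_hTail, h_neg s (by omega), Polynomial.coeff_zero]

theorem hTail_zero (s : ℕ) : hTail s 0 = 1 := by
  simp [hTail, h_zero]

theorem hTail_sub_X_mul_hTail (s : ℕ) (n : ℤ) :
    hTail s n - Polynomial.X * hTail s (n - 1) = Polynomial.C (h s n) := by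
  ext1 i
  rcases i with _ | i
  · simp [coeff_hTail]
  · rw [Polynomial.coeff_sub, Polynomial.coeff_X_mul, coeff_hTail, coeff_hTail,
      Polynomial.coeff_C_succ, sub_eq_zero]
    congr 1
    push_cast
    ring

theorem sigmaMinusB_hDet (s : ℕ) (f : Fin s → ℕ) :
    sigmaMinusB s (hDet s f) = indexDet (hTail s) f := by
  refine (transport_hDet _
    (c := fun j => ∑ i ∈ Finset.range (j + 1), Finsupp.single i (b ((j : ℤ) - i))) ?_ f).trans ?_
  · intro j
    rw [sigmaMinus_b, map_sum]
    simp_rw [polyMap_single]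
  · rw [indexDet]
    congr 1
    ext l k i
    simp only [Matrix.of_apply, map_sum, polyMap_single, LinearMap.comp_apply,
      LinearMap.proj_apply, hColumn_b, Polynomial.finsetSum_coeff, Polynomial.coeff_monomial,
      coeff_hTail, Finset.sum_ite_eq', sub_right_comm _ (l : ℤ)]
    split_ifs with hi
    · rfl
    · rw [Finset.mem_range] at hi
      rw [h_neg s (by omega)]

theorem invE_zero : invE 0 = 1 := by
  have E_zero : E 0 = 1 := by rw [E, Finset.univ_eq_empty, Finset.sum_empty, add_zero]
  rw [← E_mul_invE 0, E_zero, one_mul]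

theorem h_zero_left_natCast (n : ℕ) : h 0 n = if n = 0 then 1 else 0 := by
  rw [h_natCast, invE_zero, PowerSeries.coeff_one]

theorem sigmaMinusH_eq_hTail (s : ℕ) (n : ℤ) : sigmaMinusH s n = hTail s n := by
  rcases lt_or_ge n 0 with hn | hn
  · rw [hTail_neg s hn, sigmaMinusH, h_neg s hn, if_neg (not_le.mpr hn)]
    split_ifs
    · rfl
    · ext1 i
      refine (coeff_transport _ _ _).trans ?_
      simp
  lift n to ℕ using hn
  rcases s with _ | s
  · ext1 i
    rw [sigmaMinusH, if_pos rfl, if_pos (by positivity), coeff_hTail, Int.toNat_natCast,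
      Polynomial.coeff_X_pow]
    rcases lt_or_ge n i with hi | hi
    · rw [h_neg 0 (by omega), if_neg hi.ne']
    · rw [← Nat.cast_sub hi, h_zero_left_natCast]
      congr 1
      simp only [eq_iff_iff]
      omega
  · have hook := sigmaMinusB_hDet (s + 1) (Fin.snoc (α := fun _ => ℕ) (fun k => (k : ℕ)) (s + n))
    rw [hDet_eq_indexDet, indexDet_hook (h_zero _) (fun _ => h_neg _),
      indexDet_hook (hTail_zero _) (fun _ => hTail_neg _)] at hook
    rw [sigmaMinusH, if_neg s.succ_ne_zero, hook]

/-! ### Determinant identities -/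

section RowDifference

variable {R : Type*} [CommRing R] {n : ℕ} {x z : R}

theorem det_eq_mul_det_succ_submatrix {A : Matrix (Fin (n + 1)) (Fin (n + 1)) R}
    (hA : ∀ i : Fin n, A i.succ 0 = 0) :
    A.det = A 0 0 * (A.submatrix Fin.succ Fin.succ).det := by
  rw [Matrix.det_succ_column_zero, Fin.sum_univ_succ, Finset.sum_eq_zero, add_zero]
  · simp
  · intro i _
    rw [hA, mul_zero, zero_mul]

theorem det_vecCons_sum_smul {ι : Type*} (S : Finset ι) (c : ι → R) (v : ι → Fin (n + 1) → R)
    (D : Fin n → Fin (n + 1) → R) :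
    Matrix.det (Matrix.of (Matrix.vecCons (∑ i ∈ S, c i • v i) D)) =
      ∑ i ∈ S, c i * Matrix.det (Matrix.of (Matrix.vecCons (v i) D)) := by
  let f := (Matrix.detRowAlternating (n := Fin (n + 1)) (R := R)).toMultilinearMap.curryLeft
  suffices h : f (∑ i ∈ S, c i • v i) D = ∑ i ∈ S, c i * f (v i) D from h
  rw [map_sum, sum_apply]
  simp only [map_smul, smul_apply, smul_eq_mul]

/-- The rows `A_l - x A_{l+1}`, which for invertible `x` can replace all rows of `A` but the first
in a determinant, up to a unit. -/
def rowDiff (x : R) (A : Matrix (Fin (n + 1)) (Fin (n + 1)) R) (l : Fin n) : Fin (n + 1) → R :=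
  A l.castSucc - x • A l.succ

theorem det_eq_det_vecCons_rowDiff (hxz : x * z = 1)
    (A : Matrix (Fin (n + 1)) (Fin (n + 1)) R) :
    A.det = (-z) ^ n * Matrix.det (Matrix.of (Matrix.vecCons (A 0) (rowDiff x A))) := by
  have scale := Matrix.det_mul_column (Matrix.vecCons 1 fun _ : Fin n => -z)
    (Matrix.of (Matrix.vecCons (A 0) (rowDiff x A)))
  rw [Fin.prod_univ_succ, Matrix.cons_val_zero, one_mul] at scale
  simp only [Matrix.cons_val_succ, Fin.prod_const] at scale
  rw [← scale]
  refine Matrix.det_eq_of_forall_row_eq_smul_add_pred (fun _ => z) (fun k => ?_) fun l k => ?_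
  · simp
  · simp only [Matrix.of_apply, Matrix.cons_val_succ, rowDiff, Pi.sub_apply, Pi.smul_apply,
      smul_eq_mul]
    linear_combination (-A l.succ k) * hxz

theorem det_vecCons_row_rowDiff (hxz : x * z = 1) (A : Matrix (Fin (n + 1)) (Fin (n + 1)) R)
    (i : Fin (n + 1)) :
    Matrix.det (Matrix.of (Matrix.vecCons (A i) (rowDiff x A))) =
      z ^ (i : ℕ) * Matrix.det (Matrix.of (Matrix.vecCons (A 0) (rowDiff x A))) := by
  induction i using Fin.induction with
  | zero => simp
  | succ i ih =>
    have row_succ : A i.succ = ∑ k, ![z, -z] k • ![A i.castSucc, rowDiff x A i] k := by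
      funext k
      simp only [Fin.sum_univ_two, Matrix.cons_val_zero, Matrix.cons_val_one, rowDiff,
        Pi.add_apply, Pi.sub_apply, Pi.smul_apply, smul_eq_mul]
      linear_combination (-A i.succ k) * hxz
    have repeated_row :
        Matrix.det (Matrix.of (Matrix.vecCons (rowDiff x A i) (rowDiff x A))) = 0 :=
      Matrix.det_zero_of_row_eq (Fin.succ_ne_zero i).symm rfl
    rw [row_succ, det_vecCons_sum_smul, Fin.sum_univ_two]
    simp only [Matrix.cons_val_zero, Matrix.cons_val_one, ih, repeated_row, mul_zero, add_zero,
      Fin.val_castSucc, Fin.val_succ, pow_succ', mul_assoc]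

theorem sum_mul_det_eq_det_vecCons_sum_rowDiff (hxz : x * z = 1)
    (A : Matrix (Fin (n + 1)) (Fin (n + 1)) R) (e : Fin (n + 1) → R) :
    (∑ i, e i * z ^ (i : ℕ)) * A.det =
      (-z) ^ n * Matrix.det (Matrix.of (Matrix.vecCons (∑ i, e i • A i) (rowDiff x A))) := by
  calc _ = (-z) ^ n * ∑ i : Fin (n + 1), e i *
        (z ^ (i : ℕ) * Matrix.det (Matrix.of (Matrix.vecCons (A 0) (rowDiff x A)))) := by
        rw [det_eq_det_vecCons_rowDiff hxz A, mul_left_comm, Finset.sum_mul]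
        simp only [mul_assoc]
    _ = _ := by
      simp only [← det_vecCons_row_rowDiff hxz A]
      rw [det_vecCons_sum_smul Finset.univ e A]

/-- The row differences of the matrix `(G_{f_k - l})` are the rows `(H_{f_k - l})`; the sum on the
right is the expansion along the row `(x ^ f_k)`. -/
theorem sum_mul_indexDet (hxz : x * z = 1) {G H : ℤ → R} (hGH : ∀ m, G m - x * G (m - 1) = H m)
    {e : Fin (n + 1) → R} {f : Fin (n + 1) → ℕ}
    (he : ∀ j, ∑ i, e i * G ((f j : ℤ) - (i : ℕ)) = x ^ f j) :
    (∑ i, e i * z ^ (i : ℕ)) * indexDet G f = (-z) ^ n *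
      ∑ j : Fin (n + 1), (-1) ^ (j : ℕ) * x ^ f j * indexDet H (f ∘ j.succAbove) := by
  rw [indexDet, sum_mul_det_eq_det_vecCons_sum_rowDiff hxz, Matrix.det_succ_row_zero]
  congr 1
  refine Finset.sum_congr rfl fun j _ => ?_
  congr 2
  · simp [← he]
  · ext l k
    simp [rowDiff, ← hGH, sub_sub]

theorem indexDet_cons_zero_succ {G : ℤ → R} (hG0 : G 0 = 1) (hG : ∀ m < 0, G m = 0)
    (g : Fin n → ℕ) :
    indexDet G (Fin.cons (α := fun _ => ℕ) 0 fun k => g k + 1) = indexDet G g := by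
  rw [indexDet, det_eq_mul_det_succ_submatrix fun i => hG _ (by simp; omega)]
  simp only [Matrix.of_apply, Fin.cons_zero, Fin.val_zero, Nat.cast_zero, sub_zero, hG0, one_mul]
  congr 1
  ext l k
  simp

theorem det_cons_geometric (hxz : x * z = 1) {G H : ℤ → R}
    (hGH : ∀ m, H m - x * H (m - 1) = G m) (q : R) (g : Fin n → ℕ) :
    Matrix.det (Matrix.of fun l : Fin (n + 1) =>
        Fin.cons (α := fun _ => R) (z ^ (l : ℕ) * q) fun k => H ((g k : ℤ) - (l : ℤ))) =
      (-z) ^ n * (q * indexDet G g) := by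
  rw [det_eq_det_vecCons_rowDiff hxz, det_eq_mul_det_succ_submatrix fun i => ?_]
  · congr 2
    · simp
    · rw [indexDet]
      congr 1
      ext l k
      simp [rowDiff, ← hGH, sub_sub]
  · simp only [rowDiff, Matrix.of_apply, Matrix.cons_val_succ, Pi.sub_apply, Pi.smul_apply,
      Fin.cons_zero, Fin.val_castSucc, Fin.val_succ, smul_eq_mul]
    linear_combination (-(z ^ (i : ℕ) * q)) * hxz

end RowDifference

/-! ### The two factors of the residue -/

theorem coeff_E_of_lt (s : ℕ) {n : ℕ} (hn : s < n) : PowerSeries.coeff n (E s) = 0 := by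
  rw [E, map_add, map_sum, PowerSeries.coeff_one, if_neg (by omega), zero_add]
  refine Finset.sum_eq_zero fun j _ => ?_
  rw [PowerSeries.coeff_monomial, if_neg (by omega)]

theorem sum_coeff_E_mul_h (s : ℕ) (n : ℤ) :
    ∑ i : Fin (s + 1), PowerSeries.coeff (i : ℕ) (E s) * h s (n - (i : ℕ)) =
      if n = 0 then 1 else 0 := by
  rcases lt_or_ge n 0 with hn | hn
  · rw [if_neg hn.ne]
    exact Finset.sum_eq_zero fun i _ => by rw [h_neg s (by omega), mul_zero]
  lift n to ℕ using hn
  let summand (i : ℕ) : B s := PowerSeries.coeff i (E s) * h s ((n : ℤ) - i)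
  calc ∑ i : Fin (s + 1), summand i
    _ = ∑ i ∈ Finset.range (s + 1), summand i := Fin.sum_univ_eq_sum_range summand _
    _ = ∑ i ∈ Finset.range (s + n + 1), summand i := by
      refine Finset.sum_subset (Finset.range_mono (by omega)) fun i _ hi => ?_
      rw [Finset.mem_range] at hi
      simp only [summand, coeff_E_of_lt s (show s < i by omega), zero_mul]
    _ = ∑ i ∈ Finset.range (n + 1), summand i := by
      refine (Finset.sum_subset (Finset.range_mono (by omega)) fun i _ hi => ?_).symm
      rw [Finset.mem_range] at hi
      simp only [summand, h_neg s (show (n : ℤ) - i < 0 by omega), mul_zero]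
    _ = PowerSeries.coeff n (E s * invE s) := by
      rw [PowerSeries.coeff_mul, Finset.Nat.sum_antidiagonal_eq_sum_range_succ_mk]
      refine Finset.sum_congr rfl fun i hi => ?_
      rw [Finset.mem_range] at hi
      simp only [summand, ← h_natCast, Nat.cast_sub (show i ≤ n by omega)]
    _ = _ := by simp only [E_mul_invE, PowerSeries.coeff_one, Nat.cast_eq_zero]

theorem sum_coeff_E_mul_hTail (s n : ℕ) :
    ∑ i : Fin (s + 1), Polynomial.C (PowerSeries.coeff (i : ℕ) (E s)) * hTail s (n - (i : ℕ)) =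
      Polynomial.X ^ n := by
  ext1 k
  simp only [Polynomial.finsetSum_coeff, Polynomial.coeff_C_mul, coeff_hTail, sub_right_comm,
    sum_coeff_E_mul_h, Polynomial.coeff_X_pow]
  congr 1
  simp only [eq_iff_iff]
  omega

theorem E_eq_sum (s : ℕ) : E s = ∑ i : Fin (s + 1),
    PowerSeries.C (PowerSeries.coeff (i : ℕ) (E s)) * PowerSeries.X ^ (i : ℕ) := by
  ext1 n
  rw [map_sum, Fin.sum_univ_eq_sum_range (fun i => PowerSeries.coeff n
    (PowerSeries.C (PowerSeries.coeff i (E s)) * PowerSeries.X ^ i))]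
  simp_rw [PowerSeries.coeff_C_mul, PowerSeries.coeff_X_pow, mul_ite, mul_one, mul_zero]
  rw [Finset.sum_ite_eq]
  split_ifs with hn
  · rfl
  · rw [Finset.mem_range] at hn
    exact coeff_E_of_lt s (by omega)

theorem ofPowerSeries_E (s : ℕ) : HahnSeries.ofPowerSeries ℤ (B s) (E s) = ∑ i : Fin (s + 1),
    HahnSeries.C (PowerSeries.coeff (i : ℕ) (E s)) * HahnSeries.single 1 1 ^ (i : ℕ) := by
  conv_lhs => rw [E_eq_sum]
  simp only [map_sum, map_mul, map_pow, HahnSeries.ofPowerSeries_C, HahnSeries.ofPowerSeries_X]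

section InvLaurent

variable {R : Type*} [CommRing R]

theorem single_neg_one_mul_single_one :
    HahnSeries.single (-1 : ℤ) (1 : R) * HahnSeries.single (1 : ℤ) (1 : R) = 1 := by
  rw [HahnSeries.single_mul_single, mul_one, neg_add_cancel]
  rfl

theorem neg_one_pow_eq_single (n : ℕ) :
    (-1 : LaurentSeries R) ^ n = HahnSeries.single 0 ((-1) ^ n) := by
  rw [← HahnSeries.C_apply, map_pow, map_neg, map_one]

theorem invLaurent_C (a : R) : invLaurent (Polynomial.C a) = HahnSeries.C a := by
  simp [invLaurent]

theorem invLaurent_X : invLaurent (Polynomial.X : Polynomial R) = HahnSeries.single (-1) 1 := by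
  simp [invLaurent]

end InvLaurent

theorem E_mul_schurDet_sigmaMinusH (s : ℕ) (lam : Ptn (s + 1)) :
    HahnSeries.ofPowerSeries ℤ (B s) (E s) * invLaurent (schurDet lam (sigmaMinusH s)) =
      ∑ j : Fin (s + 1), HahnSeries.single ((s : ℤ) - lam.index j)
        ((-1) ^ (s + j : ℕ) * hDet s (lam.index ∘ j.succAbove)) := by
  have row_difference (n : ℤ) : invLaurent (hTail s n) -
      HahnSeries.single (-1) 1 * invLaurent (hTail s (n - 1)) = HahnSeries.C (h s n) := by
    rw [← invLaurent_X, ← invLaurent_C, ← map_mul, ← map_sub, hTail_sub_X_mul_hTail]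
  have row_combination (j : Fin (s + 1)) :
      ∑ i : Fin (s + 1), HahnSeries.C (PowerSeries.coeff (i : ℕ) (E s)) *
        invLaurent (hTail s ((lam.index j : ℤ) - (i : ℕ))) =
          HahnSeries.single (-1) 1 ^ lam.index j := by
    simp only [← invLaurent_X, ← invLaurent_C, ← map_mul, ← map_sum, ← map_pow,
      sum_coeff_E_mul_hTail]
  rw [ofPowerSeries_E, schurDet_eq_indexDet, map_indexDet, funext (sigmaMinusH_eq_hTail s)]
  refine (sum_mul_indexDet single_neg_one_mul_single_one row_difference row_combination).trans ?_
  rw [Finset.mul_sum]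
  refine Finset.sum_congr rfl fun j _ => ?_
  have minor_eq : indexDet (fun n => (HahnSeries.C (h s n) : LaurentSeries (B s)))
      (lam.index ∘ j.succAbove) = HahnSeries.single 0 (hDet s (lam.index ∘ j.succAbove)) :=
    (map_indexDet (HahnSeries.C : B s →+* LaurentSeries (B s)) (h s) _).symm
  rw [minor_eq, neg_pow, neg_one_pow_eq_single, neg_one_pow_eq_single, HahnSeries.single_pow,
    HahnSeries.single_pow]
  simp only [HahnSeries.single_mul_single, one_pow, mul_one, nsmul_eq_mul]
  congr 1
  · congr 1
    ring
  · ring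

theorem index_succ {r : ℕ} (mu : Ptn r) :
    mu.succ.index = Fin.cons (α := fun _ => ℕ) 0 fun k => mu.index k + 1 := by
  funext k
  induction k using Fin.cases with
  | zero => simp [Ptn.index, Ptn.succ]
  | succ k =>
    rw [Fin.cons_succ, Ptn.index, Ptn.index, Ptn.succ]
    simp only [Fin.rev_succ, Fin.snoc_castSucc, Fin.val_succ]
    omega

theorem invE_mul_sigmaBarMinusB (r : ℕ) (mu : Ptn r) :
    HahnSeries.ofPowerSeries ℤ (B (r + 1)) (invE (r + 1)) *
        invLaurent (sigmaBarMinusB (r + 1) (schurDet mu.succ (h (r + 1)))) =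
      HahnSeries.single (-(r : ℤ)) ((-1) ^ r) * Matrix.det (Matrix.of fun l : Fin (r + 1) =>
        Fin.cons (α := fun _ => LaurentSeries (B (r + 1)))
          (HahnSeries.single 1 1 ^ (l : ℕ) * HahnSeries.ofPowerSeries ℤ _ (invE (r + 1)))
          fun k => HahnSeries.C (h (r + 1) ((mu.index k : ℤ) - (l : ℤ)))) := by
  let G (n : ℤ) : Polynomial (B (r + 1)) :=
    Polynomial.C (h (r + 1) n) - Polynomial.X * Polynomial.C (h (r + 1) (n - 1))
  have G_zero : G 0 = 1 := by simp [G, h_zero, h_neg]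
  have G_neg (m : ℤ) (hm : m < 0) : G m = 0 := by
    simp [G, h_neg _ hm, h_neg (r + 1) (show m - 1 < 0 by omega)]
  have row_difference (m : ℤ) : HahnSeries.C (h (r + 1) m) -
      HahnSeries.single (-1) 1 * HahnSeries.C (h (r + 1) (m - 1)) = invLaurent (G m) := by
    rw [map_sub, map_mul, invLaurent_C, invLaurent_C, invLaurent_X]
  have single_neg_pow : HahnSeries.single (-(r : ℤ)) ((-1 : B (r + 1)) ^ r) =
      (-HahnSeries.single (-1) 1 : LaurentSeries (B (r + 1))) ^ r := by
    rw [← HahnSeries.single_neg, HahnSeries.single_pow, nsmul_eq_mul, mul_neg_one]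
  have inv_pow : (-HahnSeries.single (-1) 1 : LaurentSeries (B (r + 1))) ^ r *
      (-HahnSeries.single 1 1 : LaurentSeries (B (r + 1))) ^ r = 1 := by
    rw [← mul_pow, neg_mul_neg (HahnSeries.single (-1) 1 : LaurentSeries (B (r + 1))),
      single_neg_one_mul_single_one, one_pow]
  rw [det_cons_geometric single_neg_one_mul_single_one row_difference, single_neg_pow, ← mul_assoc,
    inv_pow, one_mul, ← hDet_index, sigmaBarMinusB_hDet, index_succ,
    indexDet_cons_zero_succ G_zero G_neg, map_indexDet]
  rfl

theorem coeff_single_one_pow_mul_invE (s l i : ℕ) :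
    (HahnSeries.single (1 : ℤ) (1 : B s) ^ l * HahnSeries.ofPowerSeries ℤ (B s) (invE s)).coeff i =
      h s ((i : ℤ) - l) := by
  rw [HahnSeries.single_pow, one_pow, HahnSeries.coeff_single_mul, one_mul, nsmul_eq_mul, mul_one,
    PowerSeries.coeff_coe, h]
  rcases lt_or_ge ((i : ℤ) - l) 0 with hi | hi
  · rw [if_pos hi, if_neg (not_le.mpr hi)]
  · rw [if_neg (not_lt.mpr hi), if_pos hi]
    congr 2
    omega

theorem coeff_det_cons_invE (r i : ℕ) (g : Fin r → ℕ) :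
    (Matrix.det (Matrix.of fun l : Fin (r + 1) =>
        Fin.cons (α := fun _ => LaurentSeries (B (r + 1)))
          (HahnSeries.single 1 1 ^ (l : ℕ) * HahnSeries.ofPowerSeries ℤ _ (invE (r + 1)))
          fun k => HahnSeries.C (h (r + 1) ((g k : ℤ) - (l : ℤ))))).coeff i =
      hDet (r + 1) (Fin.cons (α := fun _ => ℕ) i g) := by
  rw [hDet, Matrix.det_succ_column_zero, Matrix.det_succ_column_zero, HahnSeries.coeff_sum]
  refine Finset.sum_congr rfl fun l _ => ?_
  let minor : Matrix (Fin r) (Fin r) (B (r + 1)) :=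
    Matrix.of fun j k => h (r + 1) ((g k : ℤ) - (l.succAbove j : ℤ))
  have minor_eq : (HahnSeries.C minor.det : LaurentSeries (B (r + 1))) =
      Matrix.det (Matrix.of fun j k : Fin r =>
        HahnSeries.C (h (r + 1) ((g k : ℤ) - (l.succAbove j : ℤ)))) :=
    RingHom.map_det _ _
  calc _ = ((-1) ^ (l : ℕ) * (HahnSeries.single 1 1 ^ (l : ℕ) *
        HahnSeries.ofPowerSeries ℤ _ (invE (r + 1))) * HahnSeries.C minor.det :
          LaurentSeries (B (r + 1))).coeff i := by rw [minor_eq]; rfl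
    _ = (-1) ^ (l : ℕ) * h (r + 1) ((i : ℤ) - (l : ℕ)) * minor.det := by
      rw [neg_one_pow_eq_single, HahnSeries.C_apply, HahnSeries.coeff_mul_single_zero,
        HahnSeries.coeff_single_zero_mul, coeff_single_one_pow_mul_invE]

theorem coeff_invE_mul_sigmaBarMinusB (r : ℕ) (mu : Ptn r) (i : ℕ) :
    (HahnSeries.ofPowerSeries ℤ (B (r + 1)) (invE (r + 1)) *
      invLaurent (sigmaBarMinusB (r + 1) (schurDet mu.succ (h (r + 1))))).coeff ((i : ℤ) - r) =
      (-1) ^ r * hDet (r + 1) (Fin.cons (α := fun _ => ℕ) i mu.index) := by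
  rw [invE_mul_sigmaBarMinusB, HahnSeries.coeff_single_mul, sub_neg_eq_add, sub_add_cancel,
    coeff_det_cons_invE]

/-! ### The residue as the Plücker form -/

theorem map_sum_single {Γ R S ι F : Type*} [PartialOrder Γ] [AddCommMonoid R] [AddCommMonoid S]
    [FunLike F R S] [AddMonoidHomClass F R S] [Fintype ι] (g : F) (k : ι → Γ) (x : ι → R) :
    (∑ j, HahnSeries.single (k j) (x j)).map g = ∑ j, HahnSeries.single (k j) (g (x j)) := by
  classical
  ext i
  simp only [HahnSeries.map_coeff, HahnSeries.coeff_sum, map_sum, HahnSeries.coeff_single]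
  refine Finset.sum_congr rfl fun j _ => ?_
  split_ifs <;> simp

theorem res_tensorSeries_sum_single {R S ι : Type*} [CommRing R] [CommRing S] [Fintype ι]
    (k : ι → ℤ) (x : ι → R) (g : LaurentSeries S) :
    res (tensorSeries (∑ j, HahnSeries.single (k j) (x j)) g) =
      ∑ j, x j ⊗ₜ[ℤ] g.coeff (-1 - k j) := by
  rw [res, tensorSeries, map_sum_single, Finset.sum_mul, HahnSeries.coeff_sum]
  refine Finset.sum_congr rfl fun j _ => ?_
  rw [HahnSeries.coeff_single_mul, HahnSeries.map_coeff, Algebra.TensorProduct.includeLeft_apply,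
    Algebra.TensorProduct.includeRight_apply, Algebra.TensorProduct.tmul_mul_tmul, mul_one, one_mul]

/-- The map `φ_s ⊗ φ_t`, followed by the inclusion of `⋀ˢ M₀ ⊗ ⋀ᵗ M₀` in `⋀ M₀ ⊗ ⋀ M₀`: it carries
the residue to a place where it can be compared with the Plücker form. -/
def phiTensor (s t : ℕ) : B s ⊗[ℤ] B t →ₗ[ℤ] ExtM0 ⊗[ℤ] ExtM0 :=
  TensorProduct.map ((Submodule.subtype _).comp (phi s).toLinearMap)
    ((Submodule.subtype _).comp (phi t).toLinearMap)

theorem phiTensor_injective (s t : ℕ) : Function.Injective (phiTensor s t) :=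
  TensorProduct.map_injective_of_flat_flat _ _
    (Subtype.val_injective.comp (phi s).injective) (Subtype.val_injective.comp (phi t).injective)

theorem phiTensor_tmul (s t : ℕ) (p : B s) (q : B t) :
    phiTensor s t (p ⊗ₜ q) = (phi s p : ExtM0) ⊗ₜ (phi t q : ExtM0) :=
  rfl

theorem phi_hDet_cons {r : ℕ} (i : ℕ) (mu : Ptn r) :
    (phi (r + 1) (hDet (r + 1) (Fin.cons (α := fun _ => ℕ) i mu.index)) : ExtM0) =
      ExteriorAlgebra.ι ℤ (b i) * (bWedge mu : ExtM0) := by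
  rw [phi_hDet, exteriorPower.ιMulti_apply_coe, ExteriorAlgebra.ιMulti_succ_apply]
  rfl

theorem phiTensor_res (s : ℕ) (lam mu : Ptn (s + 1)) :
    phiTensor s (s + 2) (res (tensorSeries
      (HahnSeries.ofPowerSeries ℤ (B s) (E s) * invLaurent (schurDet lam (sigmaMinusH s)))
      (HahnSeries.ofPowerSeries ℤ (B (s + 2)) (invE (s + 2)) *
        invLaurent (sigmaBarMinusB (s + 2) (schurDet mu.succ (h (s + 2))))))) =
      -plucker (bWedge lam : ExtM0) (bWedge mu : ExtM0) := by
  rw [E_mul_schurDet_sigmaMinusH, res_tensorSeries_sum_single, map_sum, bWedge,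
    exteriorPower.ιMulti_apply_coe, plucker_ιMulti, ← Finset.sum_neg_distrib]
  refine Finset.sum_congr rfl fun j _ => ?_
  have degree_eq : (-1 : ℤ) - (s - lam.index j) = lam.index j - (s + 1 : ℕ) := by
    push_cast
    ring
  have sign_eq : (-1 : ℤ) ^ (s + j : ℕ) * (-1) ^ (s + 1) = -(-1) ^ (j : ℕ) := by
    rw [← pow_add, show s + (j : ℕ) + (s + 1) = 2 * s + j + 1 by ring, pow_succ, pow_add,
      pow_mul, neg_one_sq, one_pow, one_mul, mul_neg_one]
  have pow_mul_eq_zsmul {t : ℕ} (n : ℕ) (p : B t) : (-1) ^ n * p = (-1 : ℤ) ^ n • p := by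
    rw [zsmul_eq_mul, Int.cast_pow, Int.cast_neg, Int.cast_one]
  calc phiTensor s (s + 2) _
    _ = phiTensor s (s + 2) (((-1 : ℤ) ^ (s + j : ℕ) * (-1) ^ (s + 1)) •
        hDet s (lam.index ∘ j.succAbove) ⊗ₜ
          hDet (s + 2) (Fin.cons (α := fun _ => ℕ) (lam.index j) mu.index)) := by
      rw [degree_eq, coeff_invE_mul_sigmaBarMinusB, pow_mul_eq_zsmul, pow_mul_eq_zsmul,
        TensorProduct.tmul_smul, ← TensorProduct.smul_tmul', smul_smul, mul_comm]
    _ = -((-1 : ℤ) ^ (j : ℕ) • ((phi s (hDet s (lam.index ∘ j.succAbove)) : ExtM0) ⊗ₜ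
          (phi (s + 2) (hDet (s + 2) (Fin.cons (α := fun _ => ℕ) (lam.index j) mu.index)) :
            ExtM0))) := by
      rw [sign_eq, map_smul, phiTensor_tmul, neg_smul]
    _ = _ := by
      rw [phi_hDet, phi_hDet_cons]
      rfl

theorem map₂_sum_smul_self {R V W α : Type*} [CommSemiring R] [AddCommMonoid V] [AddCommMonoid W]
    [Module R V] [Module R W] (β : V →ₗ[R] V →ₗ[R] W) (a : α →₀ R) (v : α → V) :
    β (a.sum fun i c => c • v i) (a.sum fun i c => c • v i) =
      a.sum fun i c => a.sum fun j d => (c * d) • β (v i) (v j) := by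
  rw [Finsupp.sum, LinearMap.map_sum₂]
  simp only [Finsupp.sum, map_sum, map_smul, LinearMap.smul_apply, smul_smul, mul_comm]

theorem map_res_sum_zsmul {R A α F : Type*} [CommRing R] [AddCommGroup A] [FunLike F R A]
    [AddMonoidHomClass F R A] (g : F) (a : α →₀ ℤ) (T : α → α → LaurentSeries R) :
    g (res (a.sum fun i c => a.sum fun j d => (c * d) • T i j)) =
      a.sum fun i c => a.sum fun j d => (c * d) • g (res (T i j)) := by
  simp only [Finsupp.sum, res, HahnSeries.coeff_sum, map_sum, ← map_zsmul]
  rfl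

theorem phiTensor_res_sum (s : ℕ) (a : Ptn (s + 1) →₀ ℤ) :
    phiTensor s (s + 2) (res (a.sum fun lam c => a.sum fun mu d =>
      (c * d) • tensorSeries
        (HahnSeries.ofPowerSeries ℤ (B s) (E s) * invLaurent (schurDet lam (sigmaMinusH s)))
        (HahnSeries.ofPowerSeries ℤ (B (s + 2)) (invE (s + 2)) *
          invLaurent (sigmaBarMinusB (s + 2) (schurDet mu.succ (h (s + 2))))))) =
      -plucker (a.sum fun lam c => c • (bWedge lam : ExtM0))
        (a.sum fun lam c => c • (bWedge lam : ExtM0)) := by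
  rw [map_res_sum_zsmul, map₂_sum_smul_self]
  simp only [phiTensor_res, smul_neg, Finsupp.sum, Finset.sum_neg_distrib]

theorem coe_sum_bWedge {r : ℕ} (a : Ptn r →₀ ℤ) :
    ((a.sum fun lam c => c • bWedge lam : ⋀[ℤ]^r M0) : ExtM0) =
      a.sum fun lam c => c • (bWedge lam : ExtM0) := by
  simp only [Finsupp.sum, Submodule.coe_sum, Submodule.coe_smul]

end

end SchubertCone

theorem mainTheorem2 (r : ℕ) (hr : 1 ≤ r) (a : Ptn r →₀ ℤ) :
    (a.sum fun lam c => c • bWedge lam) ∈ grassmannCone r ↔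
      res (a.sum fun lam c => a.sum fun mu d =>
        (c * d) • tensorSeries
          (HahnSeries.ofPowerSeries ℤ (B (r - 1)) (E (r - 1)) *
            invLaurent (schurDet lam (sigmaMinusH (r - 1))))
          (HahnSeries.ofPowerSeries ℤ (B (r + 1)) (invE (r + 1)) *
            invLaurent (sigmaBarMinusB (r + 1) (schurDet mu.succ (h (r + 1)))))) = 0 := by
  obtain ⟨s, rfl⟩ : ∃ s, r = s + 1 := ⟨r - 1, by omega⟩
  rw [mem_grassmannCone_iff, coe_sum_bWedge, ← neg_eq_zero, ← phiTensor_res_sum]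
  exact map_eq_zero_iff _ (phiTensor_injective s (s + 2))
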